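/- **Theorem 1.** Let $H$ be a separable complex Hilbert space, $\alpha,\beta>0$, $0\le\varepsilon<\pi/2$, and put $\rho(t)=\alpha^2$ for $t\in(0,1)$, $\rho(t)=\beta^2$ for $t\in(1,\infty)$. Let $A$ be a normal (in general unbounded) operator in $H$ with a compact inverse $A^{-1}$ and with spectrum contained in the sector $\{\lambda\in\mathbb C: |\arg\lambda|\le\varepsilon\}$. Let $A_0,A_1,A_2$ be linear operators in $H$ such that $B_j=A_jA^{-j}$ $(j=0,1,2)$ are everywhere defined and bounded on $H$. Put $$c_0=\frac{\kappa(\varepsilon)}{\min(\alpha^2,\beta^2)},\qquad c_1=\frac{1}{2\cos\varepsilon\,\min(\alpha,\beta)},\qquad c_2=\frac{\max(\alpha,\beta)}{\min(\alpha,\beta)}\,\kappa(\varepsilon),$$ where $\kappa(\varepsilon)=1$ for $0\le\varepsilon<\pi/4$ and $\kappa(\varepsilon)=\frac{1}{\sqrt2\cos\varepsilon}$ for $\pi/4\le\varepsilon<\pi/2$, and assume that $$c_0\|B_2\|+c_1\|B_1\|+c_2\|B_0\|<1 .$$ Then the boundary value problem $$-u''+\rho(t)A^2u+A_0u''+A_1u'+A_2u=0\quad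 (t>0),\qquad u(0)=\varphi$$ is regularly solvable in $W_2^2(\mathbb R_+;H)$, that is, there is a constant $C$ such that for every $\varphi\in H_{3/2}$ there is a $u\in W_2^2(\mathbb R_+;H)$ which satisfies the equation for almost every $t>0$, the boundary condition in the sense $\lim_{t\to+0}\|u(t)-\varphi\|_{3/2}=0$, and the estimate $\|u\|_{W_2^2(\mathbb R_+;H)}\le C\|\varphi\|_{3/2}$. Here $H_{3/2}$ is the domain of $|A|^{3/2}$, $|A|=(A^*A)^{1/2}$, with the norm $\|x\|_{3/2}=\||A|^{3/2}x\|$, and $W_2^2(\mathbb R_+;H)$ is the space of the functions $u$ with $u'',A^2u\in L_2(\mathbb R_+;H)$ (derivatives in the sense of distributions) and the norm $\big(\|u''\|_{L_2}^2+\|A^2u\|_{L_2}^2\big)^{1/2}$. -/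

import Mathlib

open MeasureTheory Set Filter Topology

open scoped ENNReal NNReal ContDiff InnerProductSpace LinearPMap

namespace OpDiffEq

variable {H : Type*} [NormedAddCommGroup H] [InnerProductSpace ℂ H]

section Operators

/-- A (possibly unbounded) operator `A` in `H` is normal if it is densely defined and closed and
`A* A = A A*`. The equality of the two products, with their natural domains, is written as an
equality of graphs: `(x, y) ∈ T.graph` means that `x` lies in the domain of `T` and `T x = y`. -/
structure IsNormal [CompleteSpace H] (A : H →ₗ.[ℂ] H) : Prop where
  dense : Dense (A.domain : Set H)
  closed : A.IsClosed
  comm : ∀ x z : H,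
    (∃ y, (x, y) ∈ A.graph ∧ (y, z) ∈ A†.graph) ↔ (∃ y, (x, y) ∈ A†.graph ∧ (y, z) ∈ A.graph)

/-- `S` is the everywhere defined bounded inverse of `A - z`. -/
structure IsResolventAt (A : H →ₗ.[ℂ] H) (z : ℂ) (S : H →L[ℂ] H) : Prop where
  right_inv : ∀ x : H, (S x, x + z • S x) ∈ A.graph
  left_inv : ∀ x y : H, (x, y) ∈ A.graph → S (y - z • x) = x

/-- The spectrum of an unbounded operator. -/
def opSpectrum (A : H →ₗ.[ℂ] H) : Set ℂ :=
  {z | ¬ ∃ S : H →L[ℂ] H, IsResolventAt A z S}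

/-- `|R| ^ γ`, where `|R| = (R* R)^{1/2}`. If `R = A⁻¹` with `A` normal, this is `|A| ^ (-γ)`. -/
noncomputable def absPow [CompleteSpace H] (R : H →L[ℂ] H) (γ : ℝ) : H →L[ℂ] H :=
  CFC.abs R ^ γ

/-- The space `H_γ`, that is the domain of `|A| ^ γ` (the range of `|A| ^ (-γ)`), where
`R = A⁻¹`. -/
noncomputable def scaleSpace [CompleteSpace H] (R : H →L[ℂ] H) (γ : ℝ) : Submodule ℂ H :=
  LinearMap.range (absPow R γ).toLinearMap

/-- The norm `‖x‖_γ = ‖|A| ^ γ x‖` of `H_γ`, extended by `∞` outside `H_γ`, where `R = A⁻¹`: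
it is the norm of the (only) vector `y` such that `|A| ^ (-γ) y = x`. -/
noncomputable def scaleNorm [CompleteSpace H] (R : H →L[ℂ] H) (γ : ℝ) (x : H) : ℝ≥0∞ :=
  ⨅ (y : H) (_ : absPow R γ y = x), ‖y‖ₑ

end Operators

section Sobolev

/-- Lebesgue measure on `R_+ = (0, ∞)`. -/
noncomputable def halfLine : Measure ℝ := volume.restrict (Ioi (0 : ℝ))

/-- `v` is the weak (distributional) derivative of `u` on `(0, ∞)`. -/
structure IsWeakDeriv (u v : ℝ → H) : Prop where
  locInt : LocallyIntegrableOn u (Ioi (0 : ℝ))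
  locInt_deriv : LocallyIntegrableOn v (Ioi (0 : ℝ))
  integral_eq : ∀ ψ : ℝ → ℝ, ContDiff ℝ ∞ ψ → HasCompactSupport ψ → tsupport ψ ⊆ Ioi (0 : ℝ) →
    ∫ t in Ioi (0 : ℝ), deriv ψ t • u t = - ∫ t in Ioi (0 : ℝ), ψ t • v t

/-- `u` belongs to `W_2^2(R_+; H)`, with `u' = u₁`, `u'' = u₂` and `A² u = w`. -/
structure MemW22 (A : H →ₗ.[ℂ] H) (u u₁ u₂ w : ℝ → H) : Prop where
  deriv_one : IsWeakDeriv u u₁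
  deriv_two : IsWeakDeriv u₁ u₂
  memLp_deriv_two : MemLp u₂ 2 halfLine
  sq_apply : ∀ᵐ t ∂halfLine, ∃ y, (u t, y) ∈ A.graph ∧ (y, w t) ∈ A.graph
  memLp_sq : MemLp w 2 halfLine

/-- The norm `(‖u''‖² + ‖A² u‖²)^{1/2}` of `W_2^2(R_+; H)`, where `u'' = u₂` and `A² u = w`. -/
noncomputable def w22Norm (u₂ w : ℝ → H) : ℝ≥0∞ :=
  (eLpNorm u₂ 2 halfLine ^ 2 + eLpNorm w 2 halfLine ^ 2) ^ (1 / 2 : ℝ)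

end Sobolev

section Problem

/-- The discontinuous coefficient: `α²` on `(0, 1)` and `β²` on `(1, ∞)`. -/
noncomputable def rho (α β t : ℝ) : ℝ := if t < 1 then α ^ 2 else β ^ 2

/-- For almost every `t > 0`, with `u' = u₁`, `u'' = u₂` and `A² u = w`,
`-u'' + ρ(t) A² u + A₀ u'' + A₁ u' + A₂ u = 0`. -/
def SolvesEquation (Aj : Fin 3 → (H →ₗ.[ℂ] H)) (α β : ℝ) (u u₁ u₂ w : ℝ → H) : Prop :=
  ∀ᵐ t ∂halfLine, ∃ a₀ a₁ a₂ : H,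
    (u₂ t, a₀) ∈ (Aj 0).graph ∧ (u₁ t, a₁) ∈ (Aj 1).graph ∧ (u t, a₂) ∈ (Aj 2).graph ∧
      -u₂ t + ((rho α β t : ℝ) : ℂ) • w t + a₀ + a₁ + a₂ = 0

/-- Regular solvability of the boundary value problem
`-u'' + ρ(t) A² u + A₀ u'' + A₁ u' + A₂ u = 0`, `u(0) = φ`, where `R = A⁻¹`: there is a constant
`C` such that every `φ ∈ H_{3/2}` admits `u ∈ W_2^2(R_+; H)` which satisfies the equation almost
everywhere, the boundary condition in the sense that `‖u(t) - φ‖_{3/2} → 0` as `t → +0`, and the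
estimate `‖u‖ ≤ C ‖φ‖_{3/2}`. -/
def RegularlySolvable [CompleteSpace H] (A : H →ₗ.[ℂ] H) (R : H →L[ℂ] H)
    (Aj : Fin 3 → (H →ₗ.[ℂ] H)) (α β : ℝ) : Prop :=
  ∃ C : ℝ≥0, ∀ φ ∈ scaleSpace R (3 / 2), ∃ u u₁ u₂ w : ℝ → H,
    MemW22 A u u₁ u₂ w ∧ SolvesEquation Aj α β u u₁ u₂ w ∧
      Tendsto (fun t => scaleNorm R (3 / 2) (u t - φ)) (𝓝[>] 0) (𝓝 0) ∧
      w22Norm u₂ w ≤ C * scaleNorm R (3 / 2) φ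

/-- The factor `1` for `ε < π/4` and `1 / (√2 cos ε)` for `π/4 ≤ ε`. -/
noncomputable def sectorFactor (ε : ℝ) : ℝ :=
  if ε < Real.pi / 4 then 1 else 1 / (Real.sqrt 2 * Real.cos ε)

/-- The constant `c₀(ε; α; β)`. -/
noncomputable def c0 (ε α β : ℝ) : ℝ := 1 / min (α ^ 2) (β ^ 2) * sectorFactor ε

/-- The constant `c₁(ε; α; β)`. -/
noncomputable def c1 (ε α β : ℝ) : ℝ := 1 / (2 * Real.cos ε * min α β)

/-- The constant `c₂(ε; α; β)`. -/
noncomputable def c2 (ε α β : ℝ) : ℝ := max α β / min α β * sectorFactor ε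

end Problem

end OpDiffEq

/-!
Let `R = A⁻¹`. Since `R` is compact, normal and injective, a maximal orthonormal set of eigenvectors
`e k` spans a dense subspace (`exists_orthonormal_eigenvectors`), and the eigenvalues `lam k` of `A`
lie in the sector. On the line through `e k` the principal part of the equation is the scalar
operator `-u'' + ρ l² u` with `l = lam k`, and everything rests on one identity for this operator.
If `f = -u'' + ρ l² u` and `u(0) = 0`, then expanding the square and integrating by parts gives
`∫ ρ⁻¹ |f|² = ∫ ρ⁻¹ |u''|² + ∫ ρ |l² u|² + 2 Re (l²) ∫ |u'|²`,
while the arithmetic-geometric mean inequality gives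
`2 |l|² ∫ |u'|² ≤ ∫ ρ⁻¹ |u''|² + ∫ ρ |l² u|²`.
As `Re (l²) ≥ (2 cos² ε - 1) |l|²`, these bound `l² u`, `l u'` and `u''` by `f` with the constants
`c₀`, `c₁` and `c₂` (`IsDecaying.energy_estimates`). The constants do not depend on `k`, so by
orthogonality the estimates hold for finite sums of modes `u ⊗ e k` and pass to their closure
(`SectorialEigenbasis.norm_le_mul_norm_principal`).

The closure is taken in the space `Quad H` of quadruples `(A² u, A u', u'', |A| ^ (3 / 2) u)`, so no
theory of vector-valued Sobolev spaces is needed. The fourth component is a bounded continuous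
function, which is possible because `|l|³ |u(t)|² ≤ ∫ |l² u|² + ∫ |l u'|²`. That the components of a
limit are related to one another by weak differentiation and by powers of `R` is a family of closed
linear conditions, which are checked on the modes.

For a constant coefficient the Dirichlet problem is solved explicitly when the right-hand side is a
test function times `e k`. By the a priori estimate the range is closed, so the principal part is
surjective; the method of continuity extends this to the step function `ρ`
(`SectorialEigenbasis.principal_surjective`). Under the smallness condition the lower order terms
are bounded by `q < 1` times the principal part, and a Neumann series keeps the operator surjective.
Finally a boundary value `φ` is lifted by `exp (-t |A|) φ`, which reduces the problem to the one
with zero boundary value (`SectorialEigenbasis.exists_solution`).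
-/

namespace OpDiffEq

/-! ### Eigenvectors of the inverse operator -/

section Spectral

variable {H : Type*} [NormedAddCommGroup H] [InnerProductSpace ℂ H]

theorem IsResolventAt.injective {A : H →ₗ.[ℂ] H} {R : H →L[ℂ] H} (hR : IsResolventAt A 0 R) :
    Function.Injective R := by
  refine (injective_iff_map_eq_zero R).2 fun x hx => ?_
  have h := hR.right_inv x
  rw [hx, smul_zero, add_zero] at h
  exact A.graph_fst_eq_zero_snd h rfl

theorem IsResolventAt.mem_graph {A : H →ₗ.[ℂ] H} {R : H →L[ℂ] H} (hR : IsResolventAt A 0 R)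
    (x : H) : (R x, x) ∈ A.graph := by
  simpa using hR.right_inv x

theorem IsResolventAt.eq_of_mem_graph {A : H →ₗ.[ℂ] H} {R : H →L[ℂ] H}
    (hR : IsResolventAt A 0 R) {x y : H} (h : (x, y) ∈ A.graph) : R y = x := by
  simpa using hR.left_inv x y h

/-- A vector which is an eigenvector of the square of a nonnegative operator is an eigenvector of
the operator itself. -/
theorem apply_eq_smul_of_sq_apply_eq {T : H →L[ℂ] H} (hT : 0 ≤ T) {t : ℝ} (ht : 0 < t) {e : H}
    (h : T (T e) = ((t ^ 2 : ℝ) : ℂ) • e) : T e = (t : ℂ) • e := by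
  have hpos : T.IsPositive := (ContinuousLinearMap.nonneg_iff_isPositive T).1 hT
  set v := T e - (t : ℂ) • e with hv
  have h1 : T v = -((t : ℂ) • v) := by
    rw [hv, map_sub, map_smul, h, smul_sub, smul_smul, neg_sub]
    push_cast
    rw [sq]
  have h2 := hpos.re_inner_nonneg_left v
  rw [h1, inner_neg_left, inner_smul_left, inner_self_eq_norm_sq_to_K] at h2
  have h3 : ‖v‖ = 0 := by
    simp at h2
    norm_cast at h2
    exact pow_eq_zero_iff two_ne_zero |>.1
      (le_antisymm (nonpos_of_mul_nonpos_right h2 ht) (sq_nonneg _))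
  exact sub_eq_zero.1 (norm_eq_zero.1 h3)

variable [CompleteSpace H]

/-- The adjoint of `A⁻¹` inverts the adjoint of `A`. -/
theorem IsResolventAt.adjoint_mem_graph {A : H →ₗ.[ℂ] H} {R : H →L[ℂ] H}
    (hA : Dense (A.domain : Set H)) (hR : IsResolventAt A 0 R) (h : H) :
    (R.adjoint h, h) ∈ A†.graph := by
  rw [LinearPMap.adjoint_graph_eq_graph_adjoint hA, Submodule.mem_adjoint_iff]
  intro a b hab
  rw [← hR.eq_of_mem_graph hab, ContinuousLinearMap.adjoint_inner_right]
  simp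

theorem IsResolventAt.adjoint_eq_of_mem_graph {A : H →ₗ.[ℂ] H} {R : H →L[ℂ] H}
    (hA : Dense (A.domain : Set H)) (hR : IsResolventAt A 0 R) {x y : H}
    (h : (x, y) ∈ A†.graph) : R.adjoint y = x := by
  rw [LinearPMap.adjoint_graph_eq_graph_adjoint hA, Submodule.mem_adjoint_iff] at h
  refine ext_inner_left ℂ fun v => ?_
  have := h (R v) v (hR.mem_graph v)
  rw [ContinuousLinearMap.adjoint_inner_right]
  exact (sub_eq_zero.1 this).symm

/-- Normality of `A`, an equality of unbounded products, becomes normality of `R = A⁻¹`. -/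
theorem IsNormal.commute_adjoint {A : H →ₗ.[ℂ] H} (hA : IsNormal A) {R : H →L[ℂ] H}
    (hR : IsResolventAt A 0 R) (h : H) : R (R.adjoint h) = R.adjoint (R h) := by
  obtain ⟨y, hy₁, hy₂⟩ := (hA.comm (R (R.adjoint h)) h).1
    ⟨R.adjoint h, hR.mem_graph _, hR.adjoint_mem_graph hA.dense h⟩
  rw [← hR.adjoint_eq_of_mem_graph hA.dense hy₁, ← hR.eq_of_mem_graph hy₂]

/-- Every nonzero closed subspace which is invariant under a compact injective normal operator and
its adjoint contains a unit eigenvector: a nonzero eigenspace of the compact self-adjoint operator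
`R* R` is finite-dimensional and invariant under `R`. -/
theorem exists_eigenvector_of_invariant {R : H →L[ℂ] H} (hRc : IsCompactOperator R)
    (hinj : Function.Injective R) (hcomm : ∀ h, R (R.adjoint h) = R.adjoint (R h))
    {W : Submodule ℂ H} (hWc : IsClosed (W : Set H)) (hW : ∀ x ∈ W, R x ∈ W)
    (hW' : ∀ x ∈ W, R.adjoint x ∈ W) (hne : W ≠ ⊥) :
    ∃ e ∈ W, ‖e‖ = 1 ∧ ∃ μ : ℂ, R e = μ • e := by
  have : CompleteSpace W := hWc.completeSpace_coe
  have : Nontrivial W := Submodule.nontrivial_iff_ne_bot.2 hne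
  let S : W →L[ℂ] W := R.restrict hW
  have hSc : IsCompactOperator S := hRc.restrict' hW
  have hadj : ∀ x : W, ((S.adjoint x : W) : H) = R.adjoint x := by
    intro x
    have : S.adjoint x = ⟨R.adjoint x, hW' x x.2⟩ := by
      refine ext_inner_left ℂ fun v => ?_
      rw [ContinuousLinearMap.adjoint_inner_right, Submodule.coe_inner, Submodule.coe_inner]
      change ⟪R (v : H), (x : H)⟫_ℂ = _
      rw [ContinuousLinearMap.adjoint_inner_right]
    rw [this]
  have hSinj : Function.Injective S := fun x y hxy =>
    Subtype.ext (hinj (congrArg Subtype.val hxy))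
  let K : W →L[ℂ] W := S.adjoint ∘L S
  have hKc : IsCompactOperator K := hSc.clm_comp S.adjoint
  have hKs : K.IsSymmetric := by
    intro x y
    simp [K, ContinuousLinearMap.adjoint_inner_left, ContinuousLinearMap.adjoint_inner_right]
  have hKinj : ∀ x, K x = 0 → x = 0 := by
    intro x hx
    have h0 : ⟪S x, S x⟫_ℂ = 0 := by
      rw [← ContinuousLinearMap.adjoint_inner_right]
      change ⟪x, K x⟫_ℂ = 0
      rw [hx, inner_zero_right]
    exact hSinj (by rw [inner_self_eq_zero.1 h0, map_zero])
  obtain ⟨μ, hμ⟩ : ∃ μ, Module.End.eigenspace (K : Module.End ℂ W) μ ≠ ⊥ := by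
    by_contra! hall
    have := ContinuousLinearMap.orthogonalComplement_iSup_eigenspaces_eq_bot hKc hKs
    simp only [hall, iSup_bot, Submodule.bot_orthogonal_eq_top] at this
    exact top_ne_bot this
  have hμ0 : μ ≠ 0 := by
    rintro rfl
    refine hμ ((Submodule.eq_bot_iff _).2 fun x hx => hKinj x ?_)
    simpa using Module.End.mem_eigenspace_iff.1 hx
  have hfin := ContinuousLinearMap.finite_dimensional_eigenspace hKc μ hμ0
  have hinv : ∀ x ∈ Module.End.eigenspace (K : Module.End ℂ W) μ,
      (S : Module.End ℂ W) x ∈ Module.End.eigenspace (K : Module.End ℂ W) μ := by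
    intro x hx
    rw [Module.End.mem_eigenspace_iff] at hx ⊢
    have hx' : K x = μ • x := hx
    change S.adjoint (S (S x)) = μ • S x
    rw [← map_smul, ← hx']
    refine Subtype.ext ?_
    rw [hadj]
    change R.adjoint (R (S x)) = R (S.adjoint (S x) : W)
    rw [hadj, hcomm]
  have : Nontrivial (Module.End.eigenspace (K : Module.End ℂ W) μ) :=
    Submodule.nontrivial_iff_ne_bot.2 hμ
  obtain ⟨ν, hν⟩ := Module.End.exists_eigenvalue ((S : Module.End ℂ W).restrict hinv)
  obtain ⟨v, hv⟩ := hν.exists_hasEigenvector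
  have hv0 : ((v : W) : H) ≠ 0 := by
    intro h
    exact hv.2 (Subtype.ext (Subtype.ext h))
  have hRv : R (v : W) = ν • ((v : W) : H) :=
    congrArg (fun z : Module.End.eigenspace (K : Module.End ℂ W) μ => ((z : W) : H))
      hv.apply_eq_smul
  refine ⟨((‖((v : W) : H)‖⁻¹ : ℝ) : ℂ) • ((v : W) : H), W.smul_mem _ (v : W).2, ?_, ν, ?_⟩
  · rw [norm_smul]
    simp [hv0]
  · rw [map_smul, hRv, smul_comm]

theorem adjoint_apply_eigenvector {R : H →L[ℂ] H}
    (hcomm : ∀ h, R (R.adjoint h) = R.adjoint (R h)) {e : H} {μ : ℂ} (hμ : R e = μ • e) :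
    R.adjoint e = starRingEnd ℂ μ • e := by
  set T := R - μ • (1 : H →L[ℂ] H) with hTdef
  have hT : T.adjoint = R.adjoint - starRingEnd ℂ μ • 1 := by
    rw [hTdef, map_sub, map_smulₛₗ, ← ContinuousLinearMap.star_eq_adjoint (1 : H →L[ℂ] H),
      star_one]
  have h0 : T e = 0 := by simp [hTdef, hμ]
  have h1 : T (T.adjoint e) = T.adjoint (T e) := by
    rw [hT]
    simp only [hTdef, sub_apply, smul_apply, one_apply_eq_self,
      map_sub, map_smul, hcomm, smul_sub]
    rw [smul_comm μ]
    abel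
  have h2 : ⟪T.adjoint e, T.adjoint e⟫_ℂ = 0 := by
    rw [ContinuousLinearMap.adjoint_inner_left, h1, h0, map_zero, inner_zero_right]
  rw [inner_self_eq_zero, hT] at h2
  simpa [sub_eq_zero] using h2

theorem apply_mem_span_orthogonal {T : H →L[ℂ] H} {s : Set H}
    (hs : ∀ e ∈ s, ∃ μ : ℂ, T.adjoint e = μ • e) {x : H} (hx : x ∈ (Submodule.span ℂ s)ᗮ) :
    T x ∈ (Submodule.span ℂ s)ᗮ := by
  rw [Submodule.mem_orthogonal] at hx ⊢
  intro u hu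
  induction hu using Submodule.span_induction with
  | mem y hy =>
    rw [← ContinuousLinearMap.adjoint_inner_left]
    obtain ⟨μ, hμ⟩ := hs y hy
    rw [hμ, inner_smul_left, hx y (Submodule.subset_span hy), mul_zero]
  | zero => exact inner_zero_left _
  | add y z _ _ hy hz => rw [inner_add_left, hy, hz, add_zero]
  | smul a y _ hy => rw [inner_smul_left, hy, mul_zero]

/-- The spectral theorem for compact injective normal operators: a maximal orthonormal set of
eigenvectors has trivial orthogonal complement. -/
theorem exists_orthonormal_eigenvectors {R : H →L[ℂ] H} (hRc : IsCompactOperator R)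
    (hinj : Function.Injective R) (hcomm : ∀ h, R (R.adjoint h) = R.adjoint (R h)) :
    ∃ s : Set H, Orthonormal ℂ ((↑) : s → H) ∧ (∀ e ∈ s, ∃ μ : ℂ, R e = μ • e) ∧
      (Submodule.span ℂ s)ᗮ = ⊥ := by
  obtain ⟨s, hs⟩ := zorn_subset
    {s : Set H | Orthonormal ℂ ((↑) : s → H) ∧ ∀ e ∈ s, ∃ μ : ℂ, R e = μ • e} (by
      intro c hc hchain
      refine ⟨⋃₀ c, ⟨orthonormal_sUnion_of_directed hchain.directedOn fun a ha => (hc ha).1, ?_⟩,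
        fun s hs => subset_sUnion_of_mem hs⟩
      rintro e ⟨a, ha, hea⟩
      exact (hc ha).2 e hea)
  refine ⟨s, hs.prop.1, hs.prop.2, ?_⟩
  by_contra hne
  obtain ⟨e, heW, he1, μ, hμ⟩ := exists_eigenvector_of_invariant hRc hinj hcomm
    (Submodule.isClosed_orthogonal (Submodule.span ℂ s))
    (fun x hx => apply_mem_span_orthogonal (fun e he => (hs.prop.2 e he).elim fun μ hμ =>
      ⟨_, adjoint_apply_eigenvector hcomm hμ⟩) hx)
    (fun x hx => apply_mem_span_orthogonal (fun e he => by
      rw [ContinuousLinearMap.adjoint_adjoint]; exact hs.prop.2 e he) hx) hne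
  have horth : ∀ x ∈ s, ⟪x, e⟫_ℂ = 0 := fun x hx =>
    (Submodule.mem_orthogonal _ _).1 heW x (Submodule.subset_span hx)
  have hes : e ∉ s := by
    intro h
    have := horth e h
    rw [inner_self_eq_zero] at this
    simp [this] at he1
  have hins : insert e s ∈ {s : Set H | Orthonormal ℂ ((↑) : s → H) ∧
      ∀ e ∈ s, ∃ μ : ℂ, R e = μ • e} := by
    refine ⟨⟨?_, ?_⟩, ?_⟩
    · rintro ⟨x, rfl | hx⟩
      · exact he1
      · exact hs.prop.1.1 ⟨x, hx⟩
    · rintro ⟨x, hx⟩ ⟨y, hy⟩ hxy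
      have hxy' : x ≠ y := fun h => hxy (Subtype.ext h)
      change ⟪x, y⟫_ℂ = 0
      rcases hx with rfl | hx <;> rcases hy with rfl | hy
      · exact absurd rfl hxy'
      · rw [inner_eq_zero_symm]; exact horth y hy
      · exact horth x hx
      · exact hs.prop.1.2 (i := ⟨x, hx⟩) (j := ⟨y, hy⟩) (fun h => hxy' (congrArg Subtype.val h))
    · rintro x (rfl | hx)
      · exact ⟨μ, hμ⟩
      · exact hs.prop.2 x hx
  exact hes (hs.le_of_ge hins (subset_insert e s) (mem_insert e s))

theorem absPow_nonneg (R : H →L[ℂ] H) (γ : ℝ) : 0 ≤ absPow R γ := CFC.rpow_nonneg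

theorem abs_apply_abs_apply (R : H →L[ℂ] H) (x : H) :
    CFC.abs R (CFC.abs R x) = R.adjoint (R x) := by
  have := congrArg (fun T : H →L[ℂ] H => T x) (CFC.abs_mul_abs R)
  simpa [ContinuousLinearMap.star_eq_adjoint] using this

theorem norm_abs_apply (R : H →L[ℂ] H) (x : H) : ‖CFC.abs R x‖ = ‖R x‖ := by
  have hpos : (CFC.abs R).IsPositive :=
    (ContinuousLinearMap.nonneg_iff_isPositive _).1 (CFC.abs_nonneg R)
  have h1 : ⟪CFC.abs R x, CFC.abs R x⟫_ℂ = ⟪R x, R x⟫_ℂ := by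
    rw [← ContinuousLinearMap.adjoint_inner_right, hpos.isSelfAdjoint.adjoint_eq,
      abs_apply_abs_apply, ContinuousLinearMap.adjoint_inner_right]
  rw [inner_self_eq_norm_sq_to_K, inner_self_eq_norm_sq_to_K] at h1
  exact (sq_eq_sq₀ (norm_nonneg _) (norm_nonneg _)).1 (by exact_mod_cast h1)

/-- Together with positivity this determines `|R| ^ (3 / 2)` on the eigenvectors of `|R|`. -/
theorem absPow_sq_apply (R : H →L[ℂ] H) (x : H) :
    absPow R (3 / 2) (absPow R (3 / 2) x) = CFC.abs R (CFC.abs R (CFC.abs R x)) := by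
  have h : absPow R (3 / 2) ^ 2 = CFC.abs R ^ 3 := by
    rw [absPow, ← CFC.rpow_natCast _ 2 CFC.rpow_nonneg,
      CFC.rpow_rpow_of_exponent_nonneg _ _ _ (by norm_num) (by norm_num) (CFC.abs_nonneg R),
      ← CFC.rpow_natCast _ 3 (CFC.abs_nonneg R)]
    norm_num
  have := congrArg (fun T : H →L[ℂ] H => T x) h
  simpa [pow_succ] using this

theorem absPow_injective {R : H →L[ℂ] H} (hinj : Function.Injective R) :
    Function.Injective (absPow R (3 / 2)) := by
  have habs : ∀ x, CFC.abs R x = 0 → x = 0 := by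
    intro x hx
    refine hinj ?_
    rw [map_zero, ← norm_eq_zero, ← norm_abs_apply, hx, norm_zero]
  refine (injective_iff_map_eq_zero _).2 fun x hx => ?_
  have := absPow_sq_apply R x
  rw [hx, map_zero] at this
  exact habs _ (habs _ (habs _ this.symm))

/-- Orthonormal eigenvectors `e k` of `R = A⁻¹` with trivial orthogonal complement, where `lam k` is
the corresponding eigenvalue of `A`. That `lam k` lies in the sector is expressed by
`Re (lam k) ≥ C |lam k|`, with `C` the cosine of half the opening angle. -/
structure SectorialEigenbasis (R : H →L[ℂ] H) (C : ℝ) (ι : Type*) where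
  /-- The eigenvectors. -/
  e : ι → H
  /-- The eigenvalues of `A = R⁻¹`. -/
  lam : ι → ℂ
  orthonormal : Orthonormal ℂ e
  orthogonal_span : (Submodule.span ℂ (range e))ᗮ = ⊥
  lam_ne_zero : ∀ k, lam k ≠ 0
  apply_e : ∀ k, R (e k) = (lam k)⁻¹ • e k
  le_re_lam : ∀ k, C * ‖lam k‖ ≤ (lam k).re

theorem SectorialEigenbasis.absPow_apply_e {R : H →L[ℂ] H} {C : ℝ} {ι : Type*}
    (b : SectorialEigenbasis R C ι) (hcomm : ∀ h, R (R.adjoint h) = R.adjoint (R h)) (k : ι) :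
    absPow R (3 / 2) (b.e k) = (((‖b.lam k‖ ^ (3 / 2 : ℝ))⁻¹ : ℝ) : ℂ) • b.e k := by
  have hpos : 0 < ‖b.lam k‖ := norm_pos_iff.2 (b.lam_ne_zero k)
  have habs : CFC.abs R (b.e k) = ((‖b.lam k‖⁻¹ : ℝ) : ℂ) • b.e k := by
    refine apply_eq_smul_of_sq_apply_eq (CFC.abs_nonneg R) (inv_pos.2 hpos) ?_
    rw [abs_apply_abs_apply, b.apply_e, map_smul,
      adjoint_apply_eigenvector hcomm (b.apply_e k), smul_smul, Complex.mul_conj,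
      Complex.normSq_eq_norm_sq, norm_inv]
  refine apply_eq_smul_of_sq_apply_eq (absPow_nonneg R _) (by positivity) ?_
  rw [absPow_sq_apply, habs, map_smul, map_smul, habs, map_smul, habs, smul_smul, smul_smul]
  congr 1
  norm_cast
  rw [inv_pow, ← Real.rpow_natCast, ← Real.rpow_mul hpos.le]
  norm_num
  ring

/-- A normal operator with compact inverse and spectrum in the sector `|arg λ| ≤ ε` has an
orthonormal eigenbasis. -/
theorem exists_sectorialEigenbasis {A : H →ₗ.[ℂ] H} (hA : IsNormal A) {R : H →L[ℂ] H}
    (hR : IsResolventAt A 0 R) (hRc : IsCompactOperator R) {ε : ℝ} (hε : ε < Real.pi / 2)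
    (hspec : ∀ z ∈ opSpectrum A, |Complex.arg z| ≤ ε) :
    ∃ s : Set H, Nonempty (SectorialEigenbasis R (Real.cos ε) s) := by
  obtain ⟨s, hs, heig, hdense⟩ := exists_orthonormal_eigenvectors hRc hR.injective
    (hA.commute_adjoint hR)
  choose! μ hμ using heig
  have hne : ∀ e ∈ s, e ≠ 0 := fun e he => hs.ne_zero ⟨e, he⟩
  have hμ0 : ∀ e ∈ s, μ e ≠ 0 := by
    intro e he h
    refine hne e he (hR.injective ?_)
    rw [hμ e he, h, zero_smul, map_zero]
  refine ⟨s, ⟨⟨fun e => e, fun e => (μ e)⁻¹, hs, by simpa using hdense,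
    fun e => inv_ne_zero (hμ0 e e.2), fun e => by rw [inv_inv]; exact hμ e e.2, fun e => ?_⟩⟩⟩
  have hmem : (μ e)⁻¹ ∈ opSpectrum A := by
    rintro ⟨S, hS⟩
    have hgr : ((e : H), (μ e)⁻¹ • (e : H)) ∈ A.graph := by
      have h1 := A.graph.smul_mem (μ e)⁻¹ (hR.mem_graph e)
      rwa [Prod.smul_mk, hμ e e.2, smul_smul, inv_mul_cancel₀ (hμ0 e e.2), one_smul] at h1
    have h2 := hS.left_inv _ _ hgr
    rw [sub_self, map_zero] at h2
    exact hne e e.2 h2.symm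
  have harg := hspec _ hmem
  rw [← Complex.norm_mul_cos_arg, mul_comm, ← Real.cos_abs (Complex.arg _)]
  exact mul_le_mul_of_nonneg_left (Real.cos_le_cos_of_nonneg_of_le_pi (abs_nonneg _)
    (by linarith [Real.pi_pos]) harg) (norm_nonneg _)

end Spectral

/-! ### Scalar functions: solvability and energy estimates -/

section Scalar

/-- Scalar functions of class `C²` on the line which, restricted to `R_+`, are square integrable
together with their first two derivatives, and which tend to `0` at infinity together with their
first derivative. -/
structure IsDecaying (u : ℝ → ℂ) : Prop where
  contDiff : ContDiff ℝ 2 u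
  memLp : MemLp u 2 halfLine
  memLp_deriv : MemLp (deriv u) 2 halfLine
  memLp_deriv_deriv : MemLp (deriv (deriv u)) 2 halfLine
  tendsto : Tendsto u atTop (𝓝 0)
  tendsto_deriv : Tendsto (deriv u) atTop (𝓝 0)

namespace IsDecaying

variable {u v : ℝ → ℂ}

theorem differentiable (hu : IsDecaying u) : Differentiable ℝ u :=
  hu.contDiff.differentiable (by norm_num)

theorem contDiff_deriv (hu : IsDecaying u) : ContDiff ℝ 1 (deriv u) :=
  ((contDiff_succ_iff_deriv (n := 1)).1 (by simpa [one_add_one_eq_two] using hu.contDiff)).2.2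

theorem differentiable_deriv (hu : IsDecaying u) : Differentiable ℝ (deriv u) :=
  hu.contDiff_deriv.differentiable (by norm_num)

theorem continuous_deriv_deriv (hu : IsDecaying u) : Continuous (deriv (deriv u)) :=
  hu.contDiff_deriv.continuous_deriv (by norm_num)

theorem zero : IsDecaying (0 : ℝ → ℂ) := by
  have h : deriv (0 : ℝ → ℂ) = 0 := by ext; simp
  refine ⟨contDiff_const, ?_, ?_, ?_, ?_, ?_⟩ <;> (try simp only [h]) <;>
    first | exact MemLp.zero | exact (tendsto_const_nhds : Tendsto (fun _ : ℝ => (0 : ℂ)) _ _)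

theorem deriv_add (hu : IsDecaying u) (hv : IsDecaying v) : deriv (u + v) = deriv u + deriv v := by
  ext t
  exact _root_.deriv_add (hu.differentiable t) (hv.differentiable t)

theorem deriv_deriv_add (hu : IsDecaying u) (hv : IsDecaying v) :
    deriv (deriv (u + v)) = deriv (deriv u) + deriv (deriv v) := by
  rw [hu.deriv_add hv]
  ext t
  exact _root_.deriv_add (hu.differentiable_deriv t) (hv.differentiable_deriv t)

theorem add (hu : IsDecaying u) (hv : IsDecaying v) : IsDecaying (u + v) where
  contDiff := hu.contDiff.add hv.contDiff
  memLp := hu.memLp.add hv.memLp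
  memLp_deriv := by rw [hu.deriv_add hv]; exact hu.memLp_deriv.add hv.memLp_deriv
  memLp_deriv_deriv := by
    rw [hu.deriv_deriv_add hv]; exact hu.memLp_deriv_deriv.add hv.memLp_deriv_deriv
  tendsto := add_zero (0 : ℂ) ▸ hu.tendsto.add hv.tendsto
  tendsto_deriv := by
    rw [hu.deriv_add hv]; exact add_zero (0 : ℂ) ▸ hu.tendsto_deriv.add hv.tendsto_deriv

theorem deriv_smul (c : ℂ) (u : ℝ → ℂ) : deriv (c • u) = c • deriv u := by
  ext t
  exact deriv_const_smul_field c u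

theorem smul (c : ℂ) (hu : IsDecaying u) : IsDecaying (c • u) where
  contDiff := contDiff_const.smul hu.contDiff
  memLp := hu.memLp.const_smul c
  memLp_deriv := by rw [deriv_smul]; exact hu.memLp_deriv.const_smul c
  memLp_deriv_deriv := by
    rw [deriv_smul, deriv_smul]; exact hu.memLp_deriv_deriv.const_smul c
  tendsto := smul_zero (A := ℂ) c ▸ hu.tendsto.const_smul c
  tendsto_deriv := by
    rw [deriv_smul]; exact smul_zero (A := ℂ) c ▸ hu.tendsto_deriv.const_smul c

end IsDecaying

/-- The space of decaying functions. -/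
def decaying : Submodule ℂ (ℝ → ℂ) where
  carrier := {u | IsDecaying u}
  zero_mem' := IsDecaying.zero
  add_mem' hu hv := hu.add hv
  smul_mem' c _ hu := hu.smul c

theorem memLp_of_isBigO_exp {f : ℝ → ℂ} (hf : Continuous f) {δ : ℝ} (hδ : 0 < δ)
    (hO : f =O[atTop] fun t => Real.exp (-δ * t)) : MemLp f 2 halfLine := by
  rw [memLp_two_iff_integrable_sq_norm hf.aestronglyMeasurable]
  refine integrable_of_isBigO_exp_neg (b := 2 * δ) (by positivity)
    (by fun_prop : Continuous fun t => ‖f t‖ ^ 2).continuousOn ?_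
  refine (hO.norm_left.pow 2).congr_right fun t => ?_
  rw [← Real.exp_nat_mul]
  congr 1
  push_cast
  ring

theorem tendsto_zero_of_isBigO_exp {f : ℝ → ℂ} {δ : ℝ} (hδ : 0 < δ)
    (hO : f =O[atTop] fun t => Real.exp (-δ * t)) : Tendsto f atTop (𝓝 0) :=
  hO.trans_tendsto (Real.tendsto_exp_atBot.comp
    (tendsto_id.const_mul_atTop_of_neg (neg_neg_iff_pos.2 hδ)))

theorem isDecaying_of_isBigO_exp {u u₁ u₂ : ℝ → ℂ} (h₁ : ∀ t, HasDerivAt u (u₁ t) t)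
    (h₂ : ∀ t, HasDerivAt u₁ (u₂ t) t) (hc : Continuous u₂) {δ : ℝ} (hδ : 0 < δ)
    (hO : u =O[atTop] fun t => Real.exp (-δ * t)) (hO₁ : u₁ =O[atTop] fun t => Real.exp (-δ * t))
    (hO₂ : u₂ =O[atTop] fun t => Real.exp (-δ * t)) : IsDecaying u := by
  have e₁ : deriv u = u₁ := funext fun t => (h₁ t).deriv
  have e₂ : deriv u₁ = u₂ := funext fun t => (h₂ t).deriv
  have hd₁ : Differentiable ℝ u := fun t => (h₁ t).differentiableAt
  have hd₂ : Differentiable ℝ u₁ := fun t => (h₂ t).differentiableAt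
  have hC₁ : ContDiff ℝ 1 u₁ := contDiff_one_iff_deriv.2 ⟨hd₂, by rwa [e₂]⟩
  refine ⟨?_, memLp_of_isBigO_exp hd₁.continuous hδ hO, ?_, ?_,
    tendsto_zero_of_isBigO_exp hδ hO, ?_⟩
  · rw [← one_add_one_eq_two, contDiff_succ_iff_deriv]
    exact ⟨hd₁, by simp, by rwa [e₁]⟩
  · rw [e₁]; exact memLp_of_isBigO_exp hd₂.continuous hδ hO₁
  · rw [e₁, e₂]; exact memLp_of_isBigO_exp hc hδ hO₂
  · rw [e₁]; exact tendsto_zero_of_isBigO_exp hδ hO₁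

theorem isBigO_cexp (μ : ℂ) :
    (fun t : ℝ => Complex.exp (-μ * t)) =O[atTop] fun t => Real.exp (-μ.re * t) := by
  refine Asymptotics.IsBigO.of_bound 1 (Eventually.of_forall fun t => ?_)
  rw [Complex.norm_exp, Real.norm_eq_abs, Real.abs_exp]
  simp

theorem hasDerivAt_cexp (μ : ℂ) (t : ℝ) :
    HasDerivAt (fun t : ℝ => Complex.exp (μ * t)) (μ * Complex.exp (μ * t)) t := by
  have h := (((hasDerivAt_id (t : ℂ)).const_mul μ).cexp).comp_ofReal
  simpa [mul_comm] using h

theorem isDecaying_cexp {μ : ℂ} (hμ : 0 < μ.re) :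
    IsDecaying fun t : ℝ => Complex.exp (-μ * t) := by
  refine isDecaying_of_isBigO_exp (hasDerivAt_cexp (-μ))
    (fun t => (hasDerivAt_cexp (-μ) t).const_mul (-μ)) (by fun_prop) hμ (isBigO_cexp μ)
    ((isBigO_cexp μ).const_mul_left _) (((isBigO_cexp μ).const_mul_left _).const_mul_left _)

/-- The equation `-u'' + μ² u = ψ`, `u(0) = 0`, with `Re μ > 0` is solved through the factorization
`(-∂ + μ) (∂ + μ)`: first `-v' + μ v = ψ` is integrated from infinity, then `u' + μ u = v` is
integrated from `0`. Beyond the support of `ψ` the solution is a multiple of `exp (-μ t)`. -/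
theorem exists_isDecaying_solution {μ : ℂ} (hμ : 0 < μ.re) {ψ : ℝ → ℝ} (hψ : Continuous ψ)
    (hs : HasCompactSupport ψ) :
    ∃ u, IsDecaying u ∧ u 0 = 0 ∧ ∀ t, -deriv (deriv u) t + μ ^ 2 * u t = ψ t := by
  obtain ⟨c, hc⟩ := hs.isCompact.bddAbove
  have hψ0 : ∀ t, c < t → ψ t = 0 := fun t ht =>
    image_eq_zero_of_notMem_tsupport fun h => not_lt.2 (hc h) ht
  have hcont₁ : Continuous fun s : ℝ => Complex.exp (-μ * s) * (ψ s : ℂ) := by fun_prop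
  -- `c` bounds the support of `ψ`, so integrating from `c` is integrating from infinity
  set v : ℝ → ℂ := fun t =>
    Complex.exp (μ * t) * -∫ s in c..t, Complex.exp (-μ * s) * (ψ s : ℂ) with hv
  have hexp : ∀ t : ℝ, Complex.exp (μ * t) * Complex.exp (-μ * t) = 1 := fun t => by
    rw [← Complex.exp_add]; simp
  have hv' : ∀ t, HasDerivAt v (μ * v t - ψ t) t := by
    intro t
    have h := (hasDerivAt_cexp μ t).mul
      (intervalIntegral.integral_hasDerivAt_right (hcont₁.intervalIntegrable c t)
        hcont₁.stronglyMeasurable.stronglyMeasurableAtFilter hcont₁.continuousAt).neg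
    refine h.congr_deriv ?_
    simp only [hv, Pi.neg_apply]
    linear_combination (-(ψ t : ℂ)) * hexp t
  have hv0 : ∀ t, c < t → v t = 0 := by
    intro t ht
    have : ∫ s in c..t, Complex.exp (-μ * s) * (ψ s : ℂ) = 0 := by
      rw [intervalIntegral.integral_of_le ht.le]
      refine setIntegral_eq_zero_of_forall_eq_zero fun s hs => ?_
      rw [hψ0 s hs.1]
      simp
    simp only [hv, this, neg_zero, mul_zero]
  have hvc : Continuous v := continuous_iff_continuousAt.2 fun t => (hv' t).continuousAt
  have hcont₂ : Continuous fun s : ℝ => Complex.exp (μ * s) * v s := by fun_prop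
  set u : ℝ → ℂ := fun t => Complex.exp (-μ * t) * ∫ s in (0 : ℝ)..t, Complex.exp (μ * s) * v s
    with hu
  have hu' : ∀ t, HasDerivAt u (-μ * u t + v t) t := by
    intro t
    have h := (hasDerivAt_cexp (-μ) t).mul
      (intervalIntegral.integral_hasDerivAt_right (hcont₂.intervalIntegrable 0 t)
        hcont₂.stronglyMeasurable.stronglyMeasurableAtFilter hcont₂.continuousAt)
    refine h.congr_deriv ?_
    simp only [hu]
    linear_combination (v t) * hexp t
  have hu'' : ∀ t, HasDerivAt (fun t => -μ * u t + v t) (μ ^ 2 * u t - ψ t) t := by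
    intro t
    refine (((hu' t).const_mul (-μ)).add (hv' t)).congr_deriv ?_
    ring
  have huc : Continuous u := continuous_iff_continuousAt.2 fun t => (hu' t).continuousAt
  have hO : u =O[atTop] fun t => Real.exp (-μ.re * t) := by
    refine ((isBigO_cexp μ).const_mul_left (∫ s in (0 : ℝ)..c, Complex.exp (μ * s) * v s)).congr'
      ?_ EventuallyEq.rfl
    filter_upwards [eventually_gt_atTop c] with t ht
    simp only [hu]
    rw [mul_comm, ← intervalIntegral.integral_add_adjacent_intervals
      (hcont₂.intervalIntegrable 0 c) (hcont₂.intervalIntegrable c t),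
      intervalIntegral.integral_of_le (a := c) ht.le,
      setIntegral_eq_zero_of_forall_eq_zero (t := Ioc c t)
        (f := fun s : ℝ => Complex.exp (μ * s) * v s) fun s hs => by rw [hv0 s hs.1, mul_zero],
      add_zero]
  have hOv : v =O[atTop] fun t => Real.exp (-μ.re * t) :=
    (Asymptotics.isBigO_zero (E' := ℂ) _ _).congr'
      ((eventually_gt_atTop c).mono fun t ht => (hv0 t ht).symm) EventuallyEq.rfl
  have hOψ : (fun t => (ψ t : ℂ)) =O[atTop] fun t => Real.exp (-μ.re * t) :=
    (Asymptotics.isBigO_zero (E' := ℂ) _ _).congr'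
      ((eventually_gt_atTop c).mono fun t ht => by simp [hψ0 t ht]) EventuallyEq.rfl
  refine ⟨u, isDecaying_of_isBigO_exp hu' hu'' (by fun_prop) hμ hO
    ((hO.const_mul_left _).add hOv) ((hO.const_mul_left _).sub hOψ), by simp [hu], fun t => ?_⟩
  rw [show deriv u = fun t => -μ * u t + v t from funext fun t => (hu' t).deriv, (hu'' t).deriv]
  ring

namespace IsDecaying

variable {u : ℝ → ℂ}

theorem integrable_mul_conj {f g : ℝ → ℂ} (hf : MemLp f 2 halfLine) (hg : MemLp g 2 halfLine) :
    Integrable (fun t => f t * starRingEnd ℂ (g t)) halfLine :=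
  hf.integrable_mul hg.star

theorem integral_deriv_deriv_mul_conj (hu : IsDecaying u) (h0 : u 0 = 0) :
    ∫ t, deriv (deriv u) t * starRingEnd ℂ (u t) ∂halfLine
      = -((∫ t, ‖deriv u t‖ ^ 2 ∂halfLine : ℝ) : ℂ) := by
  have h1 := integrable_mul_conj hu.memLp_deriv_deriv hu.memLp
  have h2 := integrable_mul_conj hu.memLp_deriv hu.memLp_deriv
  have hd : ∀ t ∈ Ici (0 : ℝ), HasDerivAt (fun t => deriv u t * starRingEnd ℂ (u t))
      (deriv (deriv u) t * starRingEnd ℂ (u t) + deriv u t * starRingEnd ℂ (deriv u t)) t :=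
    fun t _ => (hu.differentiable_deriv t).hasDerivAt.mul (hu.differentiable t).hasDerivAt.star
  have hlim : Tendsto (fun t => deriv u t * starRingEnd ℂ (u t)) atTop (𝓝 0) := by
    simpa using hu.tendsto_deriv.mul hu.tendsto.star
  have := integral_Ioi_of_hasDerivAt_of_tendsto' hd (h1.add h2) hlim
  rw [h0, map_zero, mul_zero, sub_zero] at this
  change ∫ t, _ ∂halfLine = _ at this
  rw [integral_add h1 h2] at this
  rw [eq_neg_of_add_eq_zero_left this, ← integral_complex_ofReal]
  simp_rw [Complex.mul_conj, Complex.normSq_eq_norm_sq]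

/-- The trace estimate, from `l³ |u(t)|² = -2 ∫ l³ Re (u' ū)` over `(t, ∞)`. -/
theorem norm_sq_apply_le (hu : IsDecaying u) {l : ℝ} (hl : 0 ≤ l) {t : ℝ} (ht : 0 ≤ t) :
    l ^ 3 * ‖u t‖ ^ 2 ≤ l ^ 4 * ∫ s, ‖u s‖ ^ 2 ∂halfLine
      + l ^ 2 * ∫ s, ‖deriv u s‖ ^ 2 ∂halfLine := by
  have h1 := integrable_mul_conj hu.memLp_deriv hu.memLp
  have i0 := (memLp_two_iff_integrable_sq_norm hu.memLp.1).1 hu.memLp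
  have i1 := (memLp_two_iff_integrable_sq_norm hu.memLp_deriv.1).1 hu.memLp_deriv
  have hsub : Ioi t ⊆ Ioi (0 : ℝ) := Ioi_subset_Ioi ht
  have hd : ∀ s ∈ Ici t, HasDerivAt (fun s => ‖u s‖ ^ 2) (2 * (deriv u s * starRingEnd ℂ (u s)).re)
      s := by
    intro s _
    have := (hu.differentiable s).hasDerivAt.norm_sq
    refine this.congr_deriv ?_
    rw [Complex.inner]
  have hlim : Tendsto (fun s => ‖u s‖ ^ 2) atTop (𝓝 0) := by
    simpa using hu.tendsto.norm.pow 2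
  have hi : IntegrableOn (fun s => 2 * (deriv u s * starRingEnd ℂ (u s)).re) (Ioi t) :=
    IntegrableOn.mono_set (h1.re.const_mul 2) hsub
  have key := integral_Ioi_of_hasDerivAt_of_tendsto' hd hi hlim
  rw [zero_sub] at key
  have e : l ^ 3 * ‖u t‖ ^ 2
      = ∫ s in Ioi t, -(l ^ 3 * (2 * (deriv u s * starRingEnd ℂ (u s)).re)) := by
    rw [integral_neg, integral_const_mul, key]
    ring
  have hj : Integrable (fun s => l ^ 4 * ‖u s‖ ^ 2 + l ^ 2 * ‖deriv u s‖ ^ 2) halfLine :=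
    (i0.const_mul _).add (i1.const_mul _)
  rw [e, ← integral_const_mul, ← integral_const_mul, ← integral_add (i0.const_mul _)
    (i1.const_mul _)]
  refine (integral_mono (hi.const_mul _).neg (IntegrableOn.mono_set hj hsub) fun s => ?_).trans
    (setIntegral_mono_set hj (Eventually.of_forall fun s => by positivity)
      (LE.le.eventuallyLE hsub))
  have hre : -(deriv u s * starRingEnd ℂ (u s)).re ≤ ‖deriv u s‖ * ‖u s‖ := by
    refine (neg_le_abs _).trans ((Complex.abs_re_le_norm _).trans_eq ?_)
    rw [norm_mul, RCLike.norm_conj]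
  have h3 : 0 ≤ l ^ 3 := by positivity
  change -(l ^ 3 * (2 * (deriv u s * starRingEnd ℂ (u s)).re)) ≤ _
  nlinarith [sq_nonneg (l ^ 2 * ‖u s‖ - l * ‖deriv u s‖), mul_le_mul_of_nonneg_left hre h3]

/-- The energy estimates for `f = -u'' + r l² u`, `u(0) = 0`. Expanding `∫ r⁻¹ |f|²` produces
`2 Re (l²) ∫ |u'|²`, and `∫ |l u'|²` is in turn controlled by the arithmetic-geometric mean
inequality. With the best possible `K` one has `K = κ²` for the sector factor `κ`. -/
theorem energy_estimates (hu : IsDecaying u) (h0 : u 0 = 0) {l : ℂ} {C K m M : ℝ} (hC : 0 < C)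
    (hl : C * ‖l‖ ≤ l.re) (hK : 1 ≤ K) (hCK : 1 ≤ 2 * C ^ 2 * K) (hm : 0 < m) {r : ℝ → ℝ}
    (hr : Measurable r) (hmr : ∀ t, m ≤ r t) (hrM : ∀ t, r t ≤ M) :
    let F := ∫ t, ‖-deriv (deriv u) t + l ^ 2 * (r t * u t)‖ ^ 2 ∂halfLine
    4 * C ^ 2 * m * (‖l‖ ^ 2 * ∫ t, ‖deriv u t‖ ^ 2 ∂halfLine) ≤ F ∧
      m ^ 2 * (‖l‖ ^ 4 * ∫ t, ‖u t‖ ^ 2 ∂halfLine) ≤ K * F ∧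
      m * ∫ t, ‖deriv (deriv u) t‖ ^ 2 ∂halfLine ≤ M * (K * F) := by
  intro F
  have hr0 : ∀ t, 0 < r t := fun t => hm.trans_le (hmr t)
  have hM : 0 < M := (hr0 0).trans_le (hrM 0)
  have i0 := (memLp_two_iff_integrable_sq_norm hu.memLp.1).1 hu.memLp
  have i1 := (memLp_two_iff_integrable_sq_norm hu.memLp_deriv.1).1 hu.memLp_deriv
  have i2 := (memLp_two_iff_integrable_sq_norm hu.memLp_deriv_deriv.1).1 hu.memLp_deriv_deriv
  have i3 := integrable_mul_conj hu.memLp_deriv_deriv hu.memLp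
  have hrinv : ∀ t, (r t)⁻¹ ≤ m⁻¹ := fun t => inv_anti₀ hm (hmr t)
  have iX : Integrable (fun t => (r t)⁻¹ * ‖deriv (deriv u) t‖ ^ 2) halfLine :=
    i2.bdd_mul (c := m⁻¹) hr.inv.aestronglyMeasurable (Eventually.of_forall fun t => by
      rw [Real.norm_of_nonneg (inv_nonneg.2 (hr0 t).le)]; exact hrinv t)
  have iY : Integrable (fun t => r t * (‖l‖ ^ 4 * ‖u t‖ ^ 2)) halfLine :=
    (i0.const_mul _).bdd_mul (c := M) hr.aestronglyMeasurable (Eventually.of_forall fun t => by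
      rw [Real.norm_of_nonneg (hr0 t).le]; exact hrM t)
  have iXY : Integrable (fun t => (r t)⁻¹ * ‖deriv (deriv u) t‖ ^ 2
      + r t * (‖l‖ ^ 4 * ‖u t‖ ^ 2)) halfLine := iX.add iY
  have iZ : Integrable (fun t => (starRingEnd ℂ (l ^ 2)
      * (deriv (deriv u) t * starRingEnd ℂ (u t))).re) halfLine := (i3.const_mul _).re
  have hpt : ∀ t, (r t)⁻¹ * ‖-deriv (deriv u) t + l ^ 2 * (r t * u t)‖ ^ 2
      = (r t)⁻¹ * ‖deriv (deriv u) t‖ ^ 2 + r t * (‖l‖ ^ 4 * ‖u t‖ ^ 2)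
        - 2 * (starRingEnd ℂ (l ^ 2) * (deriv (deriv u) t * starRingEnd ℂ (u t))).re := by
    intro t
    have hrt := (hr0 t).ne'
    have h4 : ‖l‖ ^ 4 * ‖u t‖ ^ 2 = ‖l ^ 2 * u t‖ ^ 2 := by
      rw [norm_mul, norm_pow]; ring
    have h5 : starRingEnd ℂ (l ^ 2) * (deriv (deriv u) t * starRingEnd ℂ (u t))
        = deriv (deriv u) t * starRingEnd ℂ (l ^ 2 * u t) := by rw [map_mul]; ring
    have h6 : l ^ 2 * (r t * u t) = r t * (l ^ 2 * u t) := by ring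
    rw [h4, h5, h6]
    generalize l ^ 2 * u t = w
    generalize deriv (deriv u) t = z
    rw [← Complex.normSq_eq_norm_sq, ← Complex.normSq_eq_norm_sq, ← Complex.normSq_eq_norm_sq]
    simp only [Complex.normSq_apply, Complex.add_re, Complex.add_im, Complex.neg_re,
      Complex.neg_im, Complex.mul_re, Complex.mul_im, Complex.ofReal_re, Complex.ofReal_im,
      Complex.conj_re, Complex.conj_im]
    field_simp
    ring
  set X := ∫ t, (r t)⁻¹ * ‖deriv (deriv u) t‖ ^ 2 ∂halfLine with hX
  set Y := ∫ t, r t * (‖l‖ ^ 4 * ‖u t‖ ^ 2) ∂halfLine with hY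
  set D := ∫ t, ‖deriv u t‖ ^ 2 ∂halfLine with hD
  have hD0 : 0 ≤ D := integral_nonneg fun t => by positivity
  have hparts := hu.integral_deriv_deriv_mul_conj h0
  rw [← hD] at hparts
  have iF : Integrable (fun t => ‖-deriv (deriv u) t + l ^ 2 * (r t * u t)‖ ^ 2) halfLine := by
    have hru : MemLp (fun t => l ^ 2 * ((r t : ℂ) * u t)) 2 halfLine := by
      refine MemLp.const_mul (hu.memLp.of_le_mul (c := M) ?_ (Eventually.of_forall fun t => ?_)) _
      · exact (Complex.measurable_ofReal.comp hr).aestronglyMeasurable.mul hu.memLp.1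
      · rw [norm_mul, Complex.norm_real, Real.norm_of_nonneg (hr0 t).le]
        exact mul_le_mul_of_nonneg_right (hrM t) (norm_nonneg _)
    have := hu.memLp_deriv_deriv.neg.add hru
    exact (memLp_two_iff_integrable_sq_norm this.1).1 this
  have hF2 : X + Y + 2 * ((l ^ 2).re * D) ≤ m⁻¹ * F := by
    have e : ∫ t, (r t)⁻¹ * ‖-deriv (deriv u) t + l ^ 2 * (r t * u t)‖ ^ 2 ∂halfLine
        = X + Y + 2 * ((l ^ 2).re * D) := by
      simp_rw [hpt]
      have e2 : ∫ t, (starRingEnd ℂ (l ^ 2) * (deriv (deriv u) t * starRingEnd ℂ (u t))).re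
          ∂halfLine = -((l ^ 2).re * D) := by
        have := integral_re (𝕜 := ℂ) (i3.const_mul (starRingEnd ℂ (l ^ 2)))
        rw [integral_const_mul, hparts] at this
        refine this.trans ?_
        rw [mul_neg, map_neg, mul_comm, RCLike.re_to_complex, Complex.re_ofReal_mul,
          Complex.conj_re, mul_comm]
      rw [integral_sub iXY (iZ.const_mul 2), integral_add iX iY, integral_const_mul, e2]
      ring
    rw [← e, ← integral_const_mul]
    refine integral_mono ?_ (iF.const_mul _) fun t =>
      mul_le_mul_of_nonneg_right (hrinv t) (by positivity)
    simp_rw [hpt]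
    exact (iX.add iY).sub (iZ.const_mul 2)
  have hG : 2 * (‖l‖ ^ 2 * D) ≤ X + Y := by
    have e : D = ∫ t, -(deriv (deriv u) t * starRingEnd ℂ (u t)).re ∂halfLine := by
      have := integral_re (𝕜 := ℂ) i3
      rw [hparts] at this
      rw [integral_neg, eq_neg_iff_add_eq_zero, add_comm, ← eq_neg_iff_add_eq_zero]
      exact this.trans (by simp)
    rw [e, ← integral_const_mul, ← integral_const_mul, hX, hY, ← integral_add iX iY]
    refine integral_mono ((i3.re.neg.const_mul _).const_mul _) (iX.add iY) fun t => ?_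
    have hre : -(deriv (deriv u) t * starRingEnd ℂ (u t)).re ≤ ‖deriv (deriv u) t‖ * ‖u t‖ := by
      refine (neg_le_abs _).trans ((Complex.abs_re_le_norm _).trans_eq ?_)
      rw [norm_mul, RCLike.norm_conj]
    have hrt := hr0 t
    have h7 : 2 * (‖l‖ ^ 2 * (‖deriv (deriv u) t‖ * ‖u t‖))
        ≤ (r t)⁻¹ * ‖deriv (deriv u) t‖ ^ 2 + r t * (‖l‖ ^ 4 * ‖u t‖ ^ 2) := by
      have h8 : (r t)⁻¹ * ‖deriv (deriv u) t‖ ^ 2 + r t * (‖l‖ ^ 4 * ‖u t‖ ^ 2)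
          - 2 * (‖l‖ ^ 2 * (‖deriv (deriv u) t‖ * ‖u t‖))
          = (r t)⁻¹ * (‖deriv (deriv u) t‖ - r t * (‖l‖ ^ 2 * ‖u t‖)) ^ 2 := by
        field_simp
        ring
      have : 0 ≤ (r t)⁻¹ * (‖deriv (deriv u) t‖ - r t * (‖l‖ ^ 2 * ‖u t‖)) ^ 2 := by positivity
      linarith
    refine le_trans ?_ h7
    change 2 * (‖l‖ ^ 2 * -(deriv (deriv u) t * starRingEnd ℂ (u t)).re) ≤ _
    gcongr
  have hre2 : (2 * C ^ 2 - 1) * ‖l‖ ^ 2 ≤ (l ^ 2).re := by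
    have h9 : (l ^ 2).re = 2 * l.re ^ 2 - ‖l‖ ^ 2 := by
      rw [← Complex.normSq_eq_norm_sq, Complex.normSq_apply, sq l, Complex.mul_re]
      ring
    have h10 : (C * ‖l‖) ^ 2 ≤ l.re ^ 2 := pow_le_pow_left₀ (by positivity) hl 2
    rw [h9]
    nlinarith
  have hS : X + Y + 2 * ((2 * C ^ 2 - 1) * (‖l‖ ^ 2 * D)) ≤ m⁻¹ * F := by
    refine le_trans ?_ hF2
    have := mul_le_mul_of_nonneg_right hre2 hD0
    linarith
  set G := ‖l‖ ^ 2 * D with hGdef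
  have hG0 : 0 ≤ G := by positivity
  have hXY : X + Y ≤ K * (m⁻¹ * F) := by
    have hS' := mul_le_mul_of_nonneg_left hS (zero_le_one.trans hK)
    -- for `2 C² ≥ 1` the term with `G` may be dropped, otherwise it is absorbed by means of `hG`
    rcases le_total 1 (2 * C ^ 2) with h | h
    · have : 0 ≤ K * ((2 * C ^ 2 - 1) * G) := by
        have : 0 ≤ 2 * C ^ 2 - 1 := by linarith
        positivity
      have hXYn : 0 ≤ X + Y := by linarith
      nlinarith [mul_le_mul_of_nonneg_right hK hXYn]
    · have hXYn : 0 ≤ X + Y := by linarith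
      have h11 : 0 ≤ K * (1 - 2 * C ^ 2) := mul_nonneg (by linarith) (by linarith)
      nlinarith [mul_le_mul_of_nonneg_left hG h11, mul_le_mul_of_nonneg_right hCK hXYn]
  have hX0 : 0 ≤ X := integral_nonneg fun t => mul_nonneg (inv_nonneg.2 (hr0 t).le) (by positivity)
  have hY0 : 0 ≤ Y := integral_nonneg fun t => mul_nonneg (hr0 t).le (by positivity)
  have hmF : m * (m⁻¹ * F) = F := by field_simp
  refine ⟨?_, ?_, ?_⟩
  · have : 4 * C ^ 2 * G ≤ m⁻¹ * F := by linarith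
    have := mul_le_mul_of_nonneg_left this hm.le
    rw [hmF] at this
    linarith
  · have h12 : m * (‖l‖ ^ 4 * ∫ t, ‖u t‖ ^ 2 ∂halfLine) ≤ Y := by
      rw [hY, ← integral_const_mul, ← integral_const_mul]
      exact integral_mono ((i0.const_mul _).const_mul _) iY fun t =>
        mul_le_mul_of_nonneg_right (hmr t) (by positivity)
    have h13 := mul_le_mul_of_nonneg_left (h12.trans (by linarith : Y ≤ K * (m⁻¹ * F))) hm.le
    calc m ^ 2 * (‖l‖ ^ 4 * ∫ t, ‖u t‖ ^ 2 ∂halfLine)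
        = m * (m * (‖l‖ ^ 4 * ∫ t, ‖u t‖ ^ 2 ∂halfLine)) := by ring
      _ ≤ m * (K * (m⁻¹ * F)) := h13
      _ = K * (m * (m⁻¹ * F)) := by ring
      _ = K * F := by rw [hmF]
  · have h14 : M⁻¹ * ∫ t, ‖deriv (deriv u) t‖ ^ 2 ∂halfLine ≤ X := by
      rw [hX, ← integral_const_mul]
      exact integral_mono (i2.const_mul _) iX fun t =>
        mul_le_mul_of_nonneg_right (inv_anti₀ (hr0 t) (hrM t)) (by positivity)
    have h15 := h14.trans (by linarith : X ≤ K * (m⁻¹ * F))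
    calc m * ∫ t, ‖deriv (deriv u) t‖ ^ 2 ∂halfLine
        = m * M * (M⁻¹ * ∫ t, ‖deriv (deriv u) t‖ ^ 2 ∂halfLine) := by field_simp
      _ ≤ m * M * (K * (m⁻¹ * F)) := by gcongr
      _ = M * (K * (m * (m⁻¹ * F))) := by ring
      _ = M * (K * F) := by rw [hmF]

end IsDecaying

end Scalar

/-! ### Bounded maps between the function spaces -/

section LpMaps

theorem memLp_top_indicator_Iio :
    MemLp ((Iio (1 : ℝ)).indicator fun _ => (1 : ℂ)) ∞ halfLine :=
  memLp_top_of_bound (aestronglyMeasurable_const.indicator measurableSet_Iio) 1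
    (Eventually.of_forall fun _ => (norm_indicator_le_norm_self _ _).trans_eq norm_one)

/-- Multiplication by the indicator of `(-∞, 1)` on `L_2(R_+; E)`. -/
noncomputable def unitCutoff (E : Type*) [NormedAddCommGroup E] [NormedSpace ℂ E] :
    Lp E 2 halfLine →L[ℂ] Lp E 2 halfLine :=
  (ContinuousLinearMap.lsmul ℂ ℂ).holderL halfLine ∞ 2 2 (memLp_top_indicator_Iio.toLp _)

variable {E : Type*} [NormedAddCommGroup E] [NormedSpace ℂ E]

theorem coeFn_unitCutoff (f : Lp E 2 halfLine) :
    unitCutoff E f =ᵐ[halfLine] (Iio (1 : ℝ)).indicator f := by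
  filter_upwards [(ContinuousLinearMap.lsmul ℂ ℂ).coeFn_holder (r := 2)
    (memLp_top_indicator_Iio.toLp _) f, memLp_top_indicator_Iio.coeFn_toLp] with t h1 h2
  rw [unitCutoff, ContinuousLinearMap.holderL_apply_apply, h1, h2]
  by_cases h : t ∈ Iio (1 : ℝ)
  · rw [indicator_of_mem h, indicator_of_mem h, ContinuousLinearMap.lsmul_apply, one_smul]
  · rw [indicator_of_notMem h, indicator_of_notMem h, map_zero, zero_apply]

theorem norm_unitCutoff_le (f : Lp E 2 halfLine) : ‖unitCutoff E f‖ ≤ ‖f‖ := by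
  refine Lp.norm_le_norm_of_ae_le ?_
  filter_upwards [coeFn_unitCutoff f] with t ht
  rw [ht]
  exact norm_indicator_le_norm_self _ _

/-- Multiplication by the step function equal to `a` on `(-∞, 1)` and to `b` on `[1, ∞)`. -/
noncomputable def stepMul (E : Type*) [NormedAddCommGroup E] [NormedSpace ℂ E] (a b : ℝ) :
    Lp E 2 halfLine →L[ℂ] Lp E 2 halfLine :=
  (b : ℂ) • ContinuousLinearMap.id ℂ _ + ((a - b : ℝ) : ℂ) • unitCutoff E

theorem coeFn_stepMul (a b : ℝ) (f : Lp E 2 halfLine) :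
    stepMul E a b f =ᵐ[halfLine] fun t => ((if t < 1 then a else b : ℝ) : ℂ) • f t := by
  have e : stepMul E a b f = (b : ℂ) • f + ((a - b : ℝ) : ℂ) • unitCutoff E f := rfl
  rw [e]
  filter_upwards [Lp.coeFn_add ((b : ℂ) • f) (((a - b : ℝ) : ℂ) • unitCutoff E f),
    Lp.coeFn_smul (b : ℂ) f, Lp.coeFn_smul ((a - b : ℝ) : ℂ) (unitCutoff E f),
    coeFn_unitCutoff f] with t h1 h2 h3 h4
  rw [h1, Pi.add_apply, h2, h3, Pi.smul_apply, Pi.smul_apply, h4]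
  by_cases h : t < 1
  · rw [indicator_of_mem (show t ∈ Iio (1 : ℝ) from h), if_pos h, ← add_smul]
    push_cast
    ring_nf
  · rw [indicator_of_notMem (show t ∉ Iio (1 : ℝ) from h), if_neg h, smul_zero, add_zero]

variable {F : Type*} [NormedAddCommGroup F] [NormedSpace ℂ F]

theorem unitCutoff_compLpL (T : E →L[ℂ] F) (f : Lp E 2 halfLine) :
    unitCutoff F (T.compLpL 2 halfLine f) = T.compLpL 2 halfLine (unitCutoff E f) := by
  ext1
  filter_upwards [coeFn_unitCutoff (T.compLpL 2 halfLine f), coeFn_unitCutoff f,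
    T.coeFn_compLpL f, T.coeFn_compLpL (unitCutoff E f)] with t h1 h2 h3 h4
  rw [h1, h4, h2]
  by_cases h : t ∈ Iio (1 : ℝ)
  · rw [indicator_of_mem h, indicator_of_mem h, h3]
  · rw [indicator_of_notMem h, indicator_of_notMem h, map_zero]

theorem stepMul_compLpL (a b : ℝ) (T : E →L[ℂ] F) (f : Lp E 2 halfLine) :
    stepMul F a b (T.compLpL 2 halfLine f) = T.compLpL 2 halfLine (stepMul E a b f) := by
  change (b : ℂ) • _ + ((a - b : ℝ) : ℂ) • unitCutoff F _
    = T.compLpL 2 halfLine ((b : ℂ) • f + ((a - b : ℝ) : ℂ) • unitCutoff E f)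
  rw [unitCutoff_compLpL, map_add, map_smul, map_smul]
  rfl

theorem memLp_ofReal_of_hasCompactSupport {ψ : ℝ → ℝ} (hc : Continuous ψ)
    (hs : HasCompactSupport ψ) : MemLp (fun t => (ψ t : ℂ)) 2 halfLine :=
  ((hc.memLp_of_hasCompactSupport hs).restrict _).ofReal

theorem integrable_test_smul {ψ : ℝ → ℝ} (hc : Continuous ψ) (hs : HasCompactSupport ψ)
    (f : Lp E 2 halfLine) : Integrable (fun t => ψ t • f t) halfLine := by
  have := memLp_one_iff_integrable.1
    ((Lp.memLp f).smul (r := 1) (memLp_ofReal_of_hasCompactSupport hc hs))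
  refine this.congr (Eventually.of_forall fun t => ?_)
  simp

theorem integrable_test_smul_bdd {ψ : ℝ → ℝ} (hc : Continuous ψ) (hs : HasCompactSupport ψ)
    (y : BoundedContinuousFunction ℝ E) : Integrable (fun t => ψ t • y t) halfLine := by
  have : Integrable (fun t => ψ t • y t) volume :=
    (hc.smul y.continuous).integrable_of_hasCompactSupport hs.smul_right
  exact this.restrict

/-- The functional `f ↦ ∫ ψ f` on `L_2(R_+; E)`, with a continuous compactly supported `ψ`. -/
noncomputable def testLp (E : Type*) [NormedAddCommGroup E] [NormedSpace ℂ E] [CompleteSpace E]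
    {ψ : ℝ → ℝ} (hc : Continuous ψ) (hs : HasCompactSupport ψ) : Lp E 2 halfLine →L[ℂ] E :=
  (ContinuousLinearMap.lsmul ℂ ℂ).lpPairing halfLine 2 2
    ((memLp_ofReal_of_hasCompactSupport hc hs).toLp _)

variable [CompleteSpace E] [CompleteSpace F] {ψ : ℝ → ℝ} (hc : Continuous ψ)
  (hs : HasCompactSupport ψ)

theorem testLp_apply (f : Lp E 2 halfLine) :
    testLp E hc hs f = ∫ t, ψ t • f t ∂halfLine := by
  rw [testLp, ContinuousLinearMap.lpPairing_eq_integral]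
  refine integral_congr_ae ?_
  filter_upwards [(memLp_ofReal_of_hasCompactSupport hc hs).coeFn_toLp] with t ht
  rw [ht]
  simp

theorem testLp_compLpL (T : E →L[ℂ] F) (f : Lp E 2 halfLine) :
    testLp F hc hs (T.compLpL 2 halfLine f) = T (testLp E hc hs f) := by
  rw [testLp_apply, testLp_apply, ← T.integral_comp_comm (integrable_test_smul hc hs f)]
  refine integral_congr_ae ?_
  filter_upwards [T.coeFn_compLpL f] with t ht
  rw [ht, ContinuousLinearMap.map_smul_of_tower]

/-- The functional `y ↦ ∫ ψ y` on bounded continuous functions, with a continuous compactly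
supported `ψ`. -/
noncomputable def testBdd (E : Type*) [NormedAddCommGroup E] [NormedSpace ℂ E] [CompleteSpace E]
    {ψ : ℝ → ℝ} (hc : Continuous ψ) (hs : HasCompactSupport ψ) :
    BoundedContinuousFunction ℝ E →L[ℂ] E :=
  LinearMap.mkContinuous
    { toFun := fun y => ∫ t, ψ t • y t ∂halfLine
      map_add' := fun y z => by
        rw [← integral_add (integrable_test_smul_bdd hc hs y) (integrable_test_smul_bdd hc hs z)]
        simp
      map_smul' := fun c y => by
        rw [RingHom.id_apply, ← integral_smul]
        refine integral_congr_ae (Eventually.of_forall fun t => ?_)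
        exact smul_comm (ψ t) c (y t) } (∫ t, ‖ψ t‖ ∂halfLine) fun y => by
      have hi : Integrable ψ halfLine := (hc.integrable_of_hasCompactSupport hs).restrict
      rw [← integral_mul_const]
      refine norm_integral_le_of_norm_le (hi.norm.mul_const _) (Eventually.of_forall fun t => ?_)
      rw [norm_smul]
      exact mul_le_mul_of_nonneg_left (y.norm_coe_le_norm t) (norm_nonneg _)

theorem testBdd_apply (y : BoundedContinuousFunction ℝ E) :
    testBdd E hc hs y = ∫ t, ψ t • y t ∂halfLine := rfl

theorem testBdd_comp (T : E →L[ℂ] F) (y : BoundedContinuousFunction ℝ E) :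
    testBdd F hc hs (T.compLeftContinuousBounded ℝ y) = T (testBdd E hc hs y) := by
  rw [testBdd_apply, testBdd_apply, ← T.integral_comp_comm (integrable_test_smul_bdd hc hs y)]
  refine integral_congr_ae (Eventually.of_forall fun t => ?_)
  simp only [ContinuousLinearMap.compLeftContinuousBounded_apply,
    ContinuousLinearMap.map_smul_of_tower]

theorem norm_sq_eq_integral {E : Type*} [NormedAddCommGroup E] [InnerProductSpace ℂ E]
    (f : Lp E 2 halfLine) : ‖f‖ ^ 2 = ∫ t, ‖f t‖ ^ 2 ∂halfLine := by
  have h := L2.inner_def (𝕜 := ℂ) f f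
  simp_rw [inner_self_eq_norm_sq_to_K] at h
  exact_mod_cast h

end LpMaps

section Tensor

variable {H : Type*} [NormedAddCommGroup H] [InnerProductSpace ℂ H]

/-- The map `f ↦ f ⊗ e` from `L_2(R_+)` to `L_2(R_+; H)`. -/
noncomputable def tensor (e : H) : Lp ℂ 2 halfLine →L[ℂ] Lp H 2 halfLine :=
  (ContinuousLinearMap.toSpanSingleton ℂ e).compLpL 2 halfLine

theorem coeFn_tensor (e : H) (f : Lp ℂ 2 halfLine) :
    tensor e f =ᵐ[halfLine] fun t => f t • e := by
  filter_upwards [(ContinuousLinearMap.toSpanSingleton ℂ e).coeFn_compLpL f] with t ht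
  rw [tensor, ht, ContinuousLinearMap.toSpanSingleton_apply]

theorem inner_tensor (e e' : H) (f g : Lp ℂ 2 halfLine) :
    ⟪tensor e f, tensor e' g⟫_ℂ = ⟪f, g⟫_ℂ * ⟪e, e'⟫_ℂ := by
  rw [L2.inner_def, L2.inner_def, ← integral_mul_const]
  refine integral_congr_ae ?_
  filter_upwards [coeFn_tensor e f, coeFn_tensor e' g] with t h1 h2
  rw [h1, h2, inner_smul_left, inner_smul_right, RCLike.inner_apply]
  ring

theorem norm_sq_sum_tensor {ι : Type*} {e : ι → H} (he : Orthonormal ℂ e) (s : Finset ι)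
    (f : ι → Lp ℂ 2 halfLine) : ‖∑ k ∈ s, tensor (e k) (f k)‖ ^ 2 = ∑ k ∈ s, ‖f k‖ ^ 2 := by
  classical
  have h : ⟪∑ k ∈ s, tensor (e k) (f k), ∑ k ∈ s, tensor (e k) (f k)⟫_ℂ
      = ∑ k ∈ s, ⟪f k, f k⟫_ℂ := by
    simp only [sum_inner, inner_sum, inner_tensor, orthonormal_iff_ite.1 he]
    refine Finset.sum_congr rfl fun k hk => ?_
    simp [hk]
  simp only [inner_self_eq_norm_sq_to_K] at h
  exact_mod_cast h

end Tensor

section ScalarMaps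

/-- The class in `L_2(R_+)` of a decaying function. -/
noncomputable def toLpZero : decaying →ₗ[ℂ] Lp ℂ 2 halfLine where
  toFun u := (u.2 : IsDecaying _).memLp.toLp _
  map_add' _ _ := rfl
  map_smul' _ _ := rfl

/-- The class in `L_2(R_+)` of the derivative of a decaying function. -/
noncomputable def toLpOne : decaying →ₗ[ℂ] Lp ℂ 2 halfLine where
  toFun u := (u.2 : IsDecaying _).memLp_deriv.toLp _
  map_add' u v := by
    rw [← MemLp.toLp_add]
    exact MemLp.toLp_congr _ _ (by rw [Submodule.coe_add, IsDecaying.deriv_add u.2 v.2])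
  map_smul' c u := by
    rw [RingHom.id_apply, ← MemLp.toLp_const_smul]
    exact MemLp.toLp_congr _ _ (by rw [Submodule.coe_smul, IsDecaying.deriv_smul])

/-- The class in `L_2(R_+)` of the second derivative of a decaying function. -/
noncomputable def toLpTwo : decaying →ₗ[ℂ] Lp ℂ 2 halfLine where
  toFun u := (u.2 : IsDecaying _).memLp_deriv_deriv.toLp _
  map_add' u v := by
    rw [← MemLp.toLp_add]
    exact MemLp.toLp_congr _ _ (by rw [Submodule.coe_add, IsDecaying.deriv_deriv_add u.2 v.2])
  map_smul' c u := by
    rw [RingHom.id_apply, ← MemLp.toLp_const_smul]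
    exact MemLp.toLp_congr _ _ (by
      rw [Submodule.coe_smul, IsDecaying.deriv_smul, IsDecaying.deriv_smul])

theorem coeFn_toLpZero (u : decaying) : toLpZero u =ᵐ[halfLine] (u : ℝ → ℂ) :=
  (u.2 : IsDecaying _).memLp.coeFn_toLp

theorem coeFn_toLpOne (u : decaying) : toLpOne u =ᵐ[halfLine] deriv (u : ℝ → ℂ) :=
  (u.2 : IsDecaying _).memLp_deriv.coeFn_toLp

theorem coeFn_toLpTwo (u : decaying) : toLpTwo u =ᵐ[halfLine] deriv (deriv (u : ℝ → ℂ)) :=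
  (u.2 : IsDecaying _).memLp_deriv_deriv.coeFn_toLp

theorem norm_sq_eq_integral_of_ae_eq {f : Lp ℂ 2 halfLine} {g : ℝ → ℂ} (h : f =ᵐ[halfLine] g) :
    ‖f‖ ^ 2 = ∫ t, ‖g t‖ ^ 2 ∂halfLine := by
  rw [norm_sq_eq_integral]
  refine integral_congr_ae ?_
  filter_upwards [h] with t ht
  rw [ht]

theorem IsDecaying.norm_apply_max_le {u : ℝ → ℂ} (hu : IsDecaying u) (t : ℝ) :
    ‖u (max t 0)‖ ≤ Real.sqrt (∫ s, ‖u s‖ ^ 2 ∂halfLine + ∫ s, ‖deriv u s‖ ^ 2 ∂halfLine) := by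
  refine Real.le_sqrt_of_sq_le ?_
  simpa using hu.norm_sq_apply_le zero_le_one (le_max_right t 0)

/-- The restriction of a decaying function to `[0, ∞)`, extended by a constant to the left, as a
bounded continuous function. -/
noncomputable def toBdd : decaying →ₗ[ℂ] BoundedContinuousFunction ℝ ℂ where
  toFun u := BoundedContinuousFunction.ofNormedAddCommGroup (fun t => (u : ℝ → ℂ) (max t 0))
    ((u.2 : IsDecaying _).contDiff.continuous.comp (by fun_prop)) _
    (u.2 : IsDecaying _).norm_apply_max_le
  map_add' _ _ := by ext; simp
  map_smul' _ _ := by ext; simp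

theorem toBdd_apply (u : decaying) (t : ℝ) : toBdd u t = (u : ℝ → ℂ) (max t 0) := rfl

variable {ψ : ℝ → ℝ}

/-- Integration by parts against a test function supported in `R_+`. -/
theorem integral_deriv_smul_eq_neg {u v : ℝ → ℂ} (hu : ∀ t, HasDerivAt u (v t) t)
    (hv : Continuous v) (hψ : ContDiff ℝ ∞ ψ) (hs : HasCompactSupport ψ)
    (h0 : tsupport ψ ⊆ Ioi (0 : ℝ)) :
    ∫ t, deriv ψ t • u t ∂halfLine = -∫ t, ψ t • v t ∂halfLine := by
  have huc : Continuous u := continuous_iff_continuousAt.2 fun t => (hu t).continuousAt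
  have hdc : Continuous (deriv ψ) := hψ.continuous_deriv (by simp)
  have i1 : Integrable (fun t => deriv ψ t • u t) halfLine :=
    ((hdc.smul huc).integrable_of_hasCompactSupport hs.deriv.smul_right).restrict
  have i2 : Integrable (fun t => ψ t • v t) halfLine :=
    ((hψ.continuous.smul hv).integrable_of_hasCompactSupport hs.smul_right).restrict
  have hd : ∀ t ∈ Ici (0 : ℝ), HasDerivAt (fun t => ψ t • u t)
      (ψ t • v t + deriv ψ t • u t) t := fun t _ =>
    ((hψ.differentiable (by simp)).differentiableAt.hasDerivAt).smul (hu t)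
  have hlim : Tendsto (fun t => ψ t • u t) atTop (𝓝 0) := by
    obtain ⟨c, hc⟩ := hs.isCompact.bddAbove
    refine tendsto_const_nhds.congr' ?_
    filter_upwards [eventually_gt_atTop c] with t ht
    rw [image_eq_zero_of_notMem_tsupport fun h => not_lt.2 (hc h) ht, zero_smul]
  have h := integral_Ioi_of_hasDerivAt_of_tendsto' hd (i2.add i1) hlim
  rw [image_eq_zero_of_notMem_tsupport fun h => lt_irrefl (0 : ℝ) (h0 h), zero_smul,
    sub_zero] at h
  change ∫ t, _ ∂halfLine = _ at h
  rw [integral_add i2 i1] at h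
  exact eq_neg_of_add_eq_zero_right h

theorem testLp_toLpZero (hc : Continuous ψ) (hs : HasCompactSupport ψ) (u : decaying) :
    testLp ℂ hc hs (toLpZero u) = testBdd ℂ hc hs (toBdd u) := by
  rw [testLp_apply, testBdd_apply]
  refine integral_congr_ae ?_
  filter_upwards [coeFn_toLpZero u, ae_restrict_mem measurableSet_Ioi] with t h1 h2
  rw [h1, toBdd_apply, max_eq_left (le_of_lt h2)]

theorem testBdd_deriv_toBdd (hψ : ContDiff ℝ ∞ ψ) (hs : HasCompactSupport ψ)
    (h0 : tsupport ψ ⊆ Ioi (0 : ℝ)) (u : decaying) :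
    testBdd ℂ (hψ.continuous_deriv (by simp)) hs.deriv (toBdd u)
      = -testLp ℂ hψ.continuous hs (toLpOne u) := by
  have hu : IsDecaying (u : ℝ → ℂ) := u.2
  rw [← testLp_toLpZero, testLp_apply, testLp_apply]
  refine Eq.trans (integral_congr_ae ?_) ((integral_deriv_smul_eq_neg
    (fun t => (hu.differentiable t).hasDerivAt) hu.contDiff_deriv.continuous hψ hs h0).trans
    (congrArg Neg.neg (integral_congr_ae ?_)))
  · filter_upwards [coeFn_toLpZero u] with t ht
    rw [ht]
  · filter_upwards [coeFn_toLpOne u] with t ht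
    rw [ht]

theorem testLp_deriv_toLpOne (hψ : ContDiff ℝ ∞ ψ) (hs : HasCompactSupport ψ)
    (h0 : tsupport ψ ⊆ Ioi (0 : ℝ)) (u : decaying) :
    testLp ℂ (hψ.continuous_deriv (by simp)) hs.deriv (toLpOne u)
      = -testLp ℂ hψ.continuous hs (toLpTwo u) := by
  have hu : IsDecaying (u : ℝ → ℂ) := u.2
  rw [testLp_apply, testLp_apply]
  refine Eq.trans (integral_congr_ae ?_) ((integral_deriv_smul_eq_neg
    (fun t => (hu.differentiable_deriv t).hasDerivAt) hu.continuous_deriv_deriv hψ hs h0).trans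
    (congrArg Neg.neg (integral_congr_ae ?_)))
  · filter_upwards [coeFn_toLpOne u] with t ht
    rw [ht]
  · filter_upwards [coeFn_toLpTwo u] with t ht
    rw [ht]

end ScalarMaps

/-! ### The space of solutions as a closure of finite sums of modes -/

section SolutionSpace

variable {H : Type*} [NormedAddCommGroup H] [InnerProductSpace ℂ H]

/-- The ambient space of quadruples `(A² u, A u', u'', |A| ^ (3 / 2) u)`; the last component, the
trace function, is measured in the uniform norm. -/
abbrev Quad (H : Type*) [NormedAddCommGroup H] [InnerProductSpace ℂ H] : Type _ :=
  Lp H 2 halfLine × Lp H 2 halfLine × Lp H 2 halfLine × BoundedContinuousFunction ℝ H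

namespace Quad

variable (H)

/-- The component `A² u`. -/
noncomputable def sq : Quad H →L[ℂ] Lp H 2 halfLine := ContinuousLinearMap.fst ℂ _ _

/-- The component `A u'`. -/
noncomputable def mid : Quad H →L[ℂ] Lp H 2 halfLine :=
  ContinuousLinearMap.fst ℂ _ _ ∘L ContinuousLinearMap.snd ℂ _ _

/-- The component `u''`. -/
noncomputable def top : Quad H →L[ℂ] Lp H 2 halfLine :=
  ContinuousLinearMap.fst ℂ _ _ ∘L ContinuousLinearMap.snd ℂ _ _ ∘L ContinuousLinearMap.snd ℂ _ _

/-- The component `|A| ^ (3 / 2) u`. -/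
noncomputable def trace : Quad H →L[ℂ] BoundedContinuousFunction ℝ H :=
  ContinuousLinearMap.snd ℂ _ _ ∘L ContinuousLinearMap.snd ℂ _ _ ∘L ContinuousLinearMap.snd ℂ _ _

/-- The principal part `-u'' + ρ A² u`, with `ρ = a` on `(0, 1)` and `ρ = b` on `(1, ∞)`. -/
noncomputable def principal (a b : ℝ) : Quad H →L[ℂ] Lp H 2 halfLine :=
  stepMul H a b ∘L sq H - top H

variable {H}

theorem norm_le {x : Quad H} {c : ℝ} (h₀ : ‖sq H x‖ ≤ c) (h₁ : ‖mid H x‖ ≤ c)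
    (h₂ : ‖top H x‖ ≤ c) (h₃ : ‖trace H x‖ ≤ c) : ‖x‖ ≤ c :=
  norm_prod_le_iff.2 ⟨h₀, norm_prod_le_iff.2 ⟨h₁, norm_prod_le_iff.2 ⟨h₂, h₃⟩⟩⟩

theorem norm_sq_le (x : Quad H) : ‖sq H x‖ ≤ ‖x‖ := norm_fst_le x

theorem norm_top_le (x : Quad H) : ‖top H x‖ ≤ ‖x‖ :=
  (norm_fst_le x.2.2).trans ((norm_snd_le x.2).trans (norm_snd_le x))

theorem principal_apply (a b : ℝ) (x : Quad H) :
    principal H a b x = stepMul H a b (sq H x) - top H x := rfl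

end Quad

variable {R : H →L[ℂ] H} {C : ℝ} {ι : Type*} (E : SectorialEigenbasis R C ι)

namespace SectorialEigenbasis

/-- The quadruple of the function `u ⊗ e k`. -/
noncomputable def mode (k : ι) : decaying →ₗ[ℂ] Quad H :=
  ((tensor (E.e k)).toLinearMap ∘ₗ (E.lam k ^ 2 • toLpZero)).prod
    (((tensor (E.e k)).toLinearMap ∘ₗ (E.lam k • toLpOne)).prod
      (((tensor (E.e k)).toLinearMap ∘ₗ toLpTwo).prod
        (((ContinuousLinearMap.toSpanSingleton ℂ (E.e k)).compLeftContinuousBounded ℝ).toLinearMap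
          ∘ₗ (((‖E.lam k‖ ^ (3 / 2 : ℝ) : ℝ) : ℂ) • toBdd))))

theorem sq_mode (k : ι) (u : decaying) :
    Quad.sq H (E.mode k u) = tensor (E.e k) (E.lam k ^ 2 • toLpZero u) := rfl

theorem mid_mode (k : ι) (u : decaying) :
    Quad.mid H (E.mode k u) = tensor (E.e k) (E.lam k • toLpOne u) := rfl

theorem top_mode (k : ι) (u : decaying) :
    Quad.top H (E.mode k u) = tensor (E.e k) (toLpTwo u) := rfl

theorem trace_mode (k : ι) (u : decaying) :
    Quad.trace H (E.mode k u)
      = (ContinuousLinearMap.toSpanSingleton ℂ (E.e k)).compLeftContinuousBounded ℝ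
        (((‖E.lam k‖ ^ (3 / 2 : ℝ) : ℝ) : ℂ) • toBdd u) := rfl

theorem trace_mode_apply (k : ι) (u : decaying) (t : ℝ) :
    Quad.trace H (E.mode k u) t
      = (((‖E.lam k‖ ^ (3 / 2 : ℝ) : ℝ) : ℂ) * (u : ℝ → ℂ) (max t 0)) • E.e k := rfl

theorem principal_mode (a b : ℝ) (k : ι) (u : decaying) :
    Quad.principal H a b (E.mode k u)
      = tensor (E.e k) (E.lam k ^ 2 • stepMul ℂ a b (toLpZero u) - toLpTwo u) := by
  rw [Quad.principal_apply, sq_mode, top_mode, map_sub, tensor, stepMul_compLpL, map_smul]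

/-- Finite sums of modes `u k ⊗ e k` with `u k ∈ N`. -/
noncomputable def trial (N : Submodule ℂ decaying) : Submodule ℂ (Quad H) :=
  LinearMap.range (Finsupp.lsum ℂ fun k => E.mode k ∘ₗ N.subtype)

variable {N : Submodule ℂ decaying}

theorem exists_eq_sum_of_mem_trial {x : Quad H} (hx : x ∈ E.trial N) :
    ∃ (s : Finset ι) (u : ι → decaying), (∀ k, u k ∈ N) ∧ x = ∑ k ∈ s, E.mode k (u k) := by
  obtain ⟨U, rfl⟩ := hx
  exact ⟨U.support, fun k => U k, fun k => (U k).2, rfl⟩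

theorem mode_mem_trial (k : ι) {u : decaying} (hu : u ∈ N) : E.mode k u ∈ E.trial N := by
  refine ⟨Finsupp.single k ⟨u, hu⟩, ?_⟩
  rw [Finsupp.lsum_single]
  rfl

/-- The closure of the finite sums of modes; for `N = ⊤` this plays the role of `W_2^2(R_+; H)`. -/
noncomputable def space (N : Submodule ℂ decaying) : Submodule ℂ (Quad H) :=
  (E.trial N).topologicalClosure

theorem isClosed_space (N : Submodule ℂ decaying) : IsClosed (E.space N : Set (Quad H)) :=
  Submodule.isClosed_topologicalClosure _

theorem trial_le_space (N : Submodule ℂ decaying) : E.trial N ≤ E.space N :=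
  Submodule.le_topologicalClosure _

/-- A closed condition which holds for all finite sums of modes holds on the whole space. -/
theorem mem_of_mem_space {P : Set (Quad H)} (hP : IsClosed P)
    (h : ∀ (s : Finset ι) (u : ι → decaying), (∀ k, u k ∈ N) → ∑ k ∈ s, E.mode k (u k) ∈ P)
    {x : Quad H} (hx : x ∈ E.space N) : x ∈ P := by
  refine closure_minimal (fun y hy => ?_) hP hx
  obtain ⟨s, u, hu, rfl⟩ := E.exists_eq_sum_of_mem_trial hy
  exact h s u hu

/-- A continuous linear map which vanishes on the modes vanishes on the whole space. -/
theorem apply_eq_zero_of_mem_space {V : Type*} [NormedAddCommGroup V] [NormedSpace ℂ V]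
    (T : Quad H →L[ℂ] V) (h : ∀ (k : ι) (u : decaying), u ∈ N → T (E.mode k u) = 0) {x : Quad H}
    (hx : x ∈ E.space N) : T x = 0 :=
  E.mem_of_mem_space (P := {x | T x = 0}) (isClosed_eq T.continuous continuous_const)
    (fun s u hu => by
      rw [mem_ofPred_eq, map_sum]
      exact Finset.sum_eq_zero fun k _ => h k (u k) (hu k)) hx

/-- The decaying functions which vanish at `0`. -/
def vanishing : Submodule ℂ decaying :=
  LinearMap.ker ((LinearMap.proj (0 : ℝ) : (ℝ → ℂ) →ₗ[ℂ] ℂ) ∘ₗ decaying.subtype)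

theorem mem_vanishing {u : decaying} : u ∈ vanishing ↔ (u : ℝ → ℂ) 0 = 0 := Iff.rfl

/-! ### A priori estimates -/

theorem norm_sq_sum_smul_e (s : Finset ι) (c : ι → ℂ) :
    ‖∑ k ∈ s, c k • E.e k‖ ^ 2 = ∑ k ∈ s, ‖c k‖ ^ 2 := by
  have h := E.orthonormal.inner_sum c c s
  simp only [inner_self_eq_norm_sq_to_K] at h
  have h2 : ∀ k, starRingEnd ℂ (c k) * c k = ((‖c k‖ ^ 2 : ℝ) : ℂ) := fun k => by
    rw [mul_comm, Complex.mul_conj, Complex.normSq_eq_norm_sq]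
  simp only [h2] at h
  refine Complex.ofReal_injective ?_
  push_cast at h ⊢
  exact h

theorem norm_sq_trace_apply_le {x : Quad H} (hx : x ∈ E.space N) (t : ℝ) :
    ‖Quad.trace H x t‖ ^ 2 ≤ ‖Quad.sq H x‖ ^ 2 + ‖Quad.mid H x‖ ^ 2 := by
  refine E.mem_of_mem_space
    (P := {x | ‖Quad.trace H x t‖ ^ 2 ≤ ‖Quad.sq H x‖ ^ 2 + ‖Quad.mid H x‖ ^ 2})
    (isClosed_le ?_ (by fun_prop)) (fun s u _ => ?_) hx
  · exact (((BoundedContinuousFunction.evalCLM ℂ t).continuous.comp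
      (Quad.trace H).continuous).norm.pow 2)
  · have e : Quad.trace H (∑ k ∈ s, E.mode k (u k)) t = ∑ k ∈ s,
        (((‖E.lam k‖ ^ (3 / 2 : ℝ) : ℝ) : ℂ) * (u k : ℝ → ℂ) (max t 0)) • E.e k := by
      rw [map_sum, BoundedContinuousFunction.sum_apply]
      rfl
    rw [mem_ofPred_eq, e, norm_sq_sum_smul_e, map_sum, map_sum]
    simp only [sq_mode, mid_mode]
    rw [norm_sq_sum_tensor E.orthonormal, norm_sq_sum_tensor E.orthonormal,
      ← Finset.sum_add_distrib]
    refine Finset.sum_le_sum fun k _ => ?_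
    have h := (u k).2.norm_sq_apply_le (norm_nonneg (E.lam k)) (le_max_right t 0)
    rw [norm_smul, norm_smul, mul_pow, mul_pow, norm_sq_eq_integral_of_ae_eq (coeFn_toLpZero _),
      norm_sq_eq_integral_of_ae_eq (coeFn_toLpOne _), norm_mul, mul_pow, Complex.norm_real,
      Real.norm_of_nonneg (by positivity), ← Real.rpow_natCast (_ ^ _),
      ← Real.rpow_mul (norm_nonneg _), norm_pow, ← pow_mul]
    norm_num at h ⊢
    exact h

theorem norm_trace_le {x : Quad H} (hx : x ∈ E.space N) :
    ‖Quad.trace H x‖ ≤ ‖Quad.sq H x‖ + ‖Quad.mid H x‖ := by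
  refine (BoundedContinuousFunction.norm_le (by positivity)).2 fun t => ?_
  refine abs_le_of_sq_le_sq' ?_ (by positivity) |>.2
  refine (E.norm_sq_trace_apply_le hx t).trans ?_
  nlinarith [mul_nonneg (norm_nonneg (Quad.sq H x)) (norm_nonneg (Quad.mid H x))]

/-- The scalar energy estimates, summed over the modes by orthogonality. -/
theorem energy_estimates {K m M a b : ℝ} (hC : 0 < C) (hK : 1 ≤ K) (hCK : 1 ≤ 2 * C ^ 2 * K)
    (hm : 0 < m) (ha : a ∈ Icc m M) (hb : b ∈ Icc m M) {x : Quad H}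
    (hx : x ∈ E.space vanishing) :
    4 * C ^ 2 * m * ‖Quad.mid H x‖ ^ 2 ≤ ‖Quad.principal H a b x‖ ^ 2 ∧
      m ^ 2 * ‖Quad.sq H x‖ ^ 2 ≤ K * ‖Quad.principal H a b x‖ ^ 2 ∧
      m * ‖Quad.top H x‖ ^ 2 ≤ M * (K * ‖Quad.principal H a b x‖ ^ 2) := by
  refine E.mem_of_mem_space
    (P := {x | 4 * C ^ 2 * m * ‖Quad.mid H x‖ ^ 2 ≤ ‖Quad.principal H a b x‖ ^ 2 ∧
      m ^ 2 * ‖Quad.sq H x‖ ^ 2 ≤ K * ‖Quad.principal H a b x‖ ^ 2 ∧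
      m * ‖Quad.top H x‖ ^ 2 ≤ M * (K * ‖Quad.principal H a b x‖ ^ 2)})
    ((isClosed_le (by fun_prop) (by fun_prop)).inter ((isClosed_le (by fun_prop)
      (by fun_prop)).inter (isClosed_le (by fun_prop) (by fun_prop)))) (fun s u hu => ?_) hx
  have hr : Measurable fun t : ℝ => if t < 1 then a else b :=
    Measurable.ite measurableSet_Iio measurable_const measurable_const
  have hest := fun k => (u k).2.energy_estimates (hu k) hC (E.le_re_lam k) hK hCK hm hr
    (fun t => by split_ifs; exacts [ha.1, hb.1]) (fun t => by split_ifs; exacts [ha.2, hb.2])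
  have hF : ∀ k, ‖E.lam k ^ 2 • stepMul ℂ a b (toLpZero (u k)) - toLpTwo (u k)‖ ^ 2
      = ∫ t, ‖-deriv (deriv (u k : ℝ → ℂ)) t + E.lam k ^ 2
        * (((if t < 1 then a else b : ℝ) : ℂ) * (u k : ℝ → ℂ) t)‖ ^ 2 ∂halfLine := by
    intro k
    refine norm_sq_eq_integral_of_ae_eq ?_
    filter_upwards [Lp.coeFn_sub (E.lam k ^ 2 • stepMul ℂ a b (toLpZero (u k))) (toLpTwo (u k)),
      Lp.coeFn_smul (E.lam k ^ 2) (stepMul ℂ a b (toLpZero (u k))),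
      coeFn_stepMul a b (toLpZero (u k)), coeFn_toLpZero (u k), coeFn_toLpTwo (u k)]
      with t h1 h2 h3 h4 h5
    rw [h1, Pi.sub_apply, h2, Pi.smul_apply, h3, h4, h5, smul_eq_mul, smul_eq_mul]
    ring
  have h0 : ∀ k, ‖E.lam k ^ 2 • toLpZero (u k)‖ ^ 2
      = ‖E.lam k‖ ^ 4 * ∫ t, ‖(u k : ℝ → ℂ) t‖ ^ 2 ∂halfLine := by
    intro k
    rw [norm_smul, mul_pow, norm_sq_eq_integral_of_ae_eq (coeFn_toLpZero _), norm_pow, ← pow_mul]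
  have h1 : ∀ k, ‖E.lam k • toLpOne (u k)‖ ^ 2
      = ‖E.lam k‖ ^ 2 * ∫ t, ‖deriv (u k : ℝ → ℂ) t‖ ^ 2 ∂halfLine := by
    intro k
    rw [norm_smul, mul_pow, norm_sq_eq_integral_of_ae_eq (coeFn_toLpOne _)]
  have h2 : ∀ k, ‖toLpTwo (u k)‖ ^ 2
      = ∫ t, ‖deriv (deriv (u k : ℝ → ℂ)) t‖ ^ 2 ∂halfLine := fun k =>
    norm_sq_eq_integral_of_ae_eq (coeFn_toLpTwo _)
  simp only [mem_ofPred_eq, map_sum, sq_mode, mid_mode, top_mode, principal_mode,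
    norm_sq_sum_tensor E.orthonormal, Finset.mul_sum]
  refine ⟨Finset.sum_le_sum fun k _ => ?_, Finset.sum_le_sum fun k _ => ?_,
    Finset.sum_le_sum fun k _ => ?_⟩
  · rw [hF, h1]; exact (hest k).1
  · rw [hF, h0]; exact (hest k).2.1
  · rw [hF, h2]; exact (hest k).2.2

/-! ### Weak derivatives -/

variable [CompleteSpace H] {ψ : ℝ → ℝ}

/-- Tested form of `u' = R (A u')`, where `u = |R| ^ (3 / 2) (|A| ^ (3 / 2) u)`. -/
theorem absPow_testBdd_deriv_trace (hcomm : ∀ h, R (R.adjoint h) = R.adjoint (R h))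
    (hψ : ContDiff ℝ ∞ ψ) (hs : HasCompactSupport ψ) (h0 : tsupport ψ ⊆ Ioi (0 : ℝ)) {x : Quad H}
    (hx : x ∈ E.space N) :
    absPow R (3 / 2) (testBdd H (hψ.continuous_deriv (by simp)) hs.deriv (Quad.trace H x))
      = -R (testLp H hψ.continuous hs (Quad.mid H x)) := by
  rw [eq_neg_iff_add_eq_zero]
  refine E.apply_eq_zero_of_mem_space (absPow R (3 / 2)
    ∘L testBdd H (hψ.continuous_deriv (by simp)) hs.deriv ∘L Quad.trace H
    + R ∘L testLp H hψ.continuous hs ∘L Quad.mid H) (fun k u _ => ?_) hx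
  have hpos : ‖E.lam k‖ ≠ 0 := norm_ne_zero_iff.2 (E.lam_ne_zero k)
  have hpos' : ((‖E.lam k‖ ^ (3 / 2 : ℝ) : ℝ) : ℂ) ≠ 0 :=
    Complex.ofReal_ne_zero.2 (Real.rpow_pos_of_pos (norm_pos_iff.2 (E.lam_ne_zero k)) _).ne'
  change absPow R (3 / 2) (testBdd H (hψ.continuous_deriv (by simp)) hs.deriv
    (Quad.trace H (E.mode k u))) + R (testLp H hψ.continuous hs (Quad.mid H (E.mode k u))) = 0
  rw [trace_mode, mid_mode, tensor, testLp_compLpL, testBdd_comp]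
  simp only [map_smul, testBdd_deriv_toBdd hψ hs h0, ContinuousLinearMap.toSpanSingleton_apply,
    E.absPow_apply_e hcomm, E.apply_e, smul_smul, smul_eq_mul]
  rw [← add_smul]
  have h := E.lam_ne_zero k
  rw [Complex.ofReal_inv]
  field_simp
  simp

/-- Tested form of `(R (A u'))' = u''`. -/
theorem apply_testLp_deriv_mid (hψ : ContDiff ℝ ∞ ψ) (hs : HasCompactSupport ψ)
    (h0 : tsupport ψ ⊆ Ioi (0 : ℝ)) {x : Quad H} (hx : x ∈ E.space N) :
    R (testLp H (hψ.continuous_deriv (by simp)) hs.deriv (Quad.mid H x))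
      = -testLp H hψ.continuous hs (Quad.top H x) := by
  rw [eq_neg_iff_add_eq_zero]
  refine E.apply_eq_zero_of_mem_space
    (R ∘L testLp H (hψ.continuous_deriv (by simp)) hs.deriv ∘L Quad.mid H
    + testLp H hψ.continuous hs ∘L Quad.top H) (fun k u _ => ?_) hx
  change R (testLp H (hψ.continuous_deriv (by simp)) hs.deriv (Quad.mid H (E.mode k u)))
    + testLp H hψ.continuous hs (Quad.top H (E.mode k u)) = 0
  rw [top_mode, mid_mode, tensor, testLp_compLpL, testLp_compLpL, map_smul,
    testLp_deriv_toLpOne hψ hs h0, ContinuousLinearMap.toSpanSingleton_apply,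
    ContinuousLinearMap.toSpanSingleton_apply, map_smul, E.apply_e, smul_smul, ← add_smul,
    smul_eq_mul]
  have h := E.lam_ne_zero k
  field_simp
  simp

/-- Tested form of `u = R² (A² u)`, where `u = |R| ^ (3 / 2) (|A| ^ (3 / 2) u)`. -/
theorem absPow_testBdd_trace (hcomm : ∀ h, R (R.adjoint h) = R.adjoint (R h))
    (hc : Continuous ψ) (hs : HasCompactSupport ψ) {x : Quad H} (hx : x ∈ E.space N) :
    absPow R (3 / 2) (testBdd H hc hs (Quad.trace H x))
      = R (R (testLp H hc hs (Quad.sq H x))) := by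
  rw [← sub_eq_zero]
  refine E.apply_eq_zero_of_mem_space (absPow R (3 / 2) ∘L testBdd H hc hs ∘L Quad.trace H
    - R ∘L R ∘L testLp H hc hs ∘L Quad.sq H) (fun k u _ => ?_) hx
  have hpos : ‖E.lam k‖ ≠ 0 := norm_ne_zero_iff.2 (E.lam_ne_zero k)
  have hpos' : ((‖E.lam k‖ ^ (3 / 2 : ℝ) : ℝ) : ℂ) ≠ 0 :=
    Complex.ofReal_ne_zero.2 (Real.rpow_pos_of_pos (norm_pos_iff.2 (E.lam_ne_zero k)) _).ne'
  change absPow R (3 / 2) (testBdd H hc hs (Quad.trace H (E.mode k u)))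
    - R (R (testLp H hc hs (Quad.sq H (E.mode k u)))) = 0
  rw [trace_mode, sq_mode, tensor, testLp_compLpL, testBdd_comp]
  simp only [map_smul, testLp_toLpZero, ContinuousLinearMap.toSpanSingleton_apply,
    E.absPow_apply_e hcomm, E.apply_e, smul_smul, smul_eq_mul]
  rw [← sub_smul]
  have h := E.lam_ne_zero k
  rw [Complex.ofReal_inv]
  field_simp
  simp

end SectorialEigenbasis

end SolutionSpace

/-! ### Solvability of the Dirichlet problem and lifts of boundary values -/

section Perturbation

theorem le_mul_of_mul_sq_le {c d κ x y : ℝ} (hc : 0 < c) (h : c * x ^ 2 ≤ d * y ^ 2)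
    (hκ : d ≤ c * κ ^ 2) (hκ0 : 0 ≤ κ) (hy : 0 ≤ y) : x ≤ κ * y := by
  refine (abs_le_of_sq_le_sq' ?_ (by positivity)).2
  have : c * x ^ 2 ≤ c * (κ * y) ^ 2 := by
    rw [mul_pow, ← mul_assoc]
    exact h.trans (mul_le_mul_of_nonneg_right hκ (sq_nonneg y))
  exact le_of_mul_le_mul_left this hc

variable {V W : Type*} [NormedAddCommGroup V] [NormedSpace ℂ V] [CompleteSpace V]
  [NormedAddCommGroup W] [NormedSpace ℂ W]

/-- An operator which is bounded below and has dense range is surjective. -/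
theorem surjective_of_bound_of_denseRange {T : V →L[ℂ] W} {K : ℝ} (hK : ∀ x, ‖x‖ ≤ K * ‖T x‖)
    (hd : DenseRange T) : Function.Surjective T := by
  have hanti : AntilipschitzWith K.toNNReal T := T.antilipschitz_of_bound fun x =>
    (hK x).trans (mul_le_mul_of_nonneg_right (Real.le_coe_toNNReal K) (norm_nonneg _))
  have hcl := hanti.isClosed_range T.uniformContinuous
  rw [← range_eq_univ, ← hcl.closure_eq, hd.closure_range]

variable [CompleteSpace W]

/-- A relatively small perturbation of a boundedly invertible operator remains surjective
(Neumann series). -/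
theorem surjective_add_of_norm_le {T S : V →L[ℂ] W} (hT : Function.Surjective T) {K q : ℝ}
    (hK : ∀ x, ‖x‖ ≤ K * ‖T x‖) (hq0 : 0 ≤ q) (hq : q < 1) (hS : ∀ x, ‖S x‖ ≤ q * ‖T x‖) :
    Function.Surjective (T + S) := by
  have hker : T.ker = ⊥ := by
    refine LinearMap.ker_eq_bot'.2 fun x hx => ?_
    have h := hK x
    have hx' : T x = 0 := hx
    rw [hx', norm_zero, mul_zero] at h
    exact norm_le_zero_iff.1 h
  let e : V ≃L[ℂ] W := ContinuousLinearEquiv.ofBijective T hker (LinearMap.range_eq_top.2 hT)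
  have he : ∀ z, T (e.symm z) = z := fun z => e.apply_symm_apply z
  let G : W →L[ℂ] W := S ∘L (e.symm : W →L[ℂ] V)
  have hG : ‖-G‖ < 1 := by
    rw [norm_neg]
    refine lt_of_le_of_lt (G.opNorm_le_bound hq0 fun z => ?_) hq
    have := hS (e.symm z)
    rwa [he] at this
  intro y
  let z := (↑(Units.oneSub (-G) hG)⁻¹ : W →L[ℂ] W) y
  refine ⟨e.symm z, ?_⟩
  have hz : (1 - -G) z = y := by
    have := congrArg (fun L : W →L[ℂ] W => L y) (Units.oneSub (-G) hG).mul_inv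
    simpa using this
  rw [sub_neg_eq_add] at hz
  change T (e.symm z) + S (e.symm z) = y
  rw [he]
  exact hz

/-- The method of continuity along the segment from `a` to `a'`. -/
theorem surjective_add_smul_of_forall_bound {T S : V →L[ℂ] W} {K c : ℝ} {a a' : ℝ}
    (hK : ∀ s ∈ segment ℝ a a', ∀ x, ‖x‖ ≤ K * ‖(T + (s : ℂ) • S) x‖)
    (hS : ∀ x, ‖S x‖ ≤ c * ‖x‖) (hc : 0 ≤ c) (hK0 : 0 ≤ K)
    (h : Function.Surjective (T + (a : ℂ) • S)) : Function.Surjective (T + (a' : ℂ) • S) := by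
  obtain ⟨n, hn⟩ := exists_nat_gt (|a' - a| * c * K)
  have hn0 : (0 : ℝ) < n := lt_of_le_of_lt (by positivity) hn
  have key : ∀ j : ℕ, j ≤ n →
      Function.Surjective (T + ((a + j / n * (a' - a) : ℝ) : ℂ) • S) := by
    intro j
    induction j with
    | zero => intro _; simpa using h
    | succ j ih =>
      intro hj
      have hjn : (j : ℝ) / n ≤ 1 := by
        rw [div_le_one hn0]
        exact_mod_cast (Nat.le_succ j).trans hj
      have hmem : a + j / n * (a' - a) ∈ segment ℝ a a' := by
        rw [segment_eq_image']
        exact ⟨j / n, ⟨by positivity, hjn⟩, rfl⟩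
      have hb := hK _ hmem
      have hstep := surjective_add_of_norm_le (S := ((1 / n * (a' - a) : ℝ) : ℂ) • S)
        (ih ((Nat.le_succ j).trans hj)) hb (q := |a' - a| * c * K / n) (by positivity)
        ((div_lt_one hn0).2 hn) (fun x => ?_)
      · convert hstep using 1
        rw [add_assoc, ← add_smul]
        push_cast
        congr 2
        ring_nf
      · rw [smul_apply, norm_smul, Complex.norm_real, Real.norm_eq_abs, abs_mul,
          abs_of_nonneg (by positivity : (0 : ℝ) ≤ 1 / n)]
        calc 1 / n * |a' - a| * ‖S x‖ ≤ 1 / n * |a' - a| * (c * (K * _)) := by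
              gcongr
              exact (hS x).trans (mul_le_mul_of_nonneg_left (hb x) hc)
          _ = _ := by ring
  have := key n le_rfl
  rwa [div_self hn0.ne', one_mul, add_sub_cancel] at this

end Perturbation

section Solvability

variable {H : Type*} [NormedAddCommGroup H] [InnerProductSpace ℂ H] {R : H →L[ℂ] H} {C : ℝ}
  {ι : Type*}

theorem locallyIntegrableOn_of_memLp {V : Type*} [NormedAddCommGroup V] {f : ℝ → V}
    (hf : MemLp f 2 halfLine) : LocallyIntegrableOn f (Ioi (0 : ℝ)) := by
  have : IsLocallyFiniteMeasure halfLine :=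
    inferInstanceAs (IsLocallyFiniteMeasure (volume.restrict (Ioi (0 : ℝ))))
  exact locallyIntegrableOn_of_locallyIntegrable_restrict (hf.locallyIntegrable (by norm_num))

namespace SectorialEigenbasis

/-- In a separable space the balls of radius `1 / 2` around orthonormal vectors are disjoint, so
there are only countably many. -/
theorem countable [TopologicalSpace.SeparableSpace H] (E : SectorialEigenbasis R C ι) :
    Countable ι := by
  have hdisj : (univ : Set ι).PairwiseDisjoint fun k => Metric.ball (E.e k) (1 / 2) := by
    intro i _ j _ hij
    refine Metric.ball_disjoint_ball ?_
    rw [dist_eq_norm]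
    have h1 : ⟪E.e i, E.e i - E.e j⟫_ℂ = 1 := by
      rw [inner_sub_right, E.orthonormal.2 hij, inner_self_eq_norm_sq_to_K, E.orthonormal.1 i]
      simp
    have h2 := norm_inner_le_norm (𝕜 := ℂ) (E.e i) (E.e i - E.e j)
    rw [h1, E.orthonormal.1 i, norm_one, one_mul] at h2
    linarith
  exact countable_univ_iff.1 (hdisj.countable_of_isOpen (fun _ _ => Metric.isOpen_ball)
    fun k _ => ⟨E.e k, Metric.mem_ball_self (by norm_num)⟩)

variable (E : SectorialEigenbasis R C ι)

/-- The a priori estimate, with a constant which is uniform in the coefficients, as the method of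
continuity requires. -/
theorem exists_norm_le_mul_norm_principal {m M : ℝ} (hC : 0 < C) (hm : 0 < m) (hmM : m ≤ M) :
    ∃ K : ℝ, 0 ≤ K ∧ ∀ a ∈ Icc m M, ∀ b ∈ Icc m M, ∀ x ∈ E.space vanishing,
      ‖x‖ ≤ K * ‖Quad.principal H a b x‖ := by
  have hM : 0 < M := hm.trans_le hmM
  -- any `k ≥ 1` with `2 C² k ≥ 1` serves, since the value of the constant does not matter here
  set k : ℝ := 1 + 1 / (2 * C ^ 2) with hk
  have hk1 : 1 ≤ k := le_add_of_nonneg_right (by positivity)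
  have hk2 : 1 ≤ 2 * C ^ 2 * k := by
    rw [hk, mul_add, mul_one_div_cancel (by positivity)]
    exact le_add_of_nonneg_left (by positivity)
  set κ₁ := Real.sqrt (1 / (4 * C ^ 2 * m))
  set κ₀ := Real.sqrt (k / m ^ 2)
  set κ₂ := Real.sqrt (M * k / m)
  refine ⟨κ₀ + κ₁ + κ₂, by positivity, fun a ha b hb x hx => ?_⟩
  obtain ⟨h1, h0, h2⟩ := E.energy_estimates hC hk1 hk2 hm ha hb hx
  set F := ‖Quad.principal H a b x‖
  have hF : 0 ≤ F := norm_nonneg _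
  have h1' : ‖Quad.mid H x‖ ≤ κ₁ * F := by
    refine le_mul_of_mul_sq_le (c := 4 * C ^ 2 * m) (d := 1) (by positivity) (by linarith) ?_
      (Real.sqrt_nonneg _) hF
    rw [Real.sq_sqrt (by positivity), mul_one_div_cancel (by positivity)]
  have h0' : ‖Quad.sq H x‖ ≤ κ₀ * F := by
    refine le_mul_of_mul_sq_le (c := m ^ 2) (d := k) (by positivity) h0 ?_
      (Real.sqrt_nonneg _) hF
    rw [Real.sq_sqrt (by positivity), mul_div_cancel₀ _ (by positivity)]
  have h2' : ‖Quad.top H x‖ ≤ κ₂ * F := by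
    refine le_mul_of_mul_sq_le (c := m) (d := M * k) (by positivity) (by linarith) ?_
      (Real.sqrt_nonneg _) hF
    rw [Real.sq_sqrt (by positivity), mul_div_cancel₀ _ (by positivity)]
  have h3' := E.norm_trace_le hx
  have n0 : 0 ≤ κ₀ * F := by positivity
  have n1 : 0 ≤ κ₁ * F := by positivity
  have n2 : 0 ≤ κ₂ * F := by positivity
  rw [add_mul, add_mul]
  exact Quad.norm_le (by linarith) (by linarith) (by linarith) (by linarith)

theorem completeSpace_space [CompleteSpace H] (N : Submodule ℂ decaying) :
    CompleteSpace (E.space N) := (E.isClosed_space N).completeSpace_coe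

/-- With a constant coefficient `b` the scalar problem on the mode `k` has the exponent
`√b lam k`, whose real part is positive. -/
theorem tensor_mem_range_principal (hC : 0 < C) {b : ℝ} (hb : 0 < b) (k : ι) {ψ : ℝ → ℝ}
    (hc : Continuous ψ) (hs : HasCompactSupport ψ) :
    ∃ x ∈ E.space vanishing, Quad.principal H b b x
      = tensor (E.e k) ((memLp_ofReal_of_hasCompactSupport hc hs).toLp _) := by
  have hre : 0 < ((Real.sqrt b : ℂ) * E.lam k).re := by
    rw [Complex.re_ofReal_mul]
    exact mul_pos (Real.sqrt_pos.2 hb) ((mul_pos hC (norm_pos_iff.2 (E.lam_ne_zero k))).trans_le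
      (E.le_re_lam k))
  obtain ⟨u, hu, hu0, heq⟩ := exists_isDecaying_solution hre hc hs
  have hsq : ((Real.sqrt b : ℂ) * E.lam k) ^ 2 = b * E.lam k ^ 2 := by
    rw [mul_pow, ← Complex.ofReal_pow, Real.sq_sqrt hb.le]
  refine ⟨E.mode k ⟨u, hu⟩, E.trial_le_space _ (E.mode_mem_trial k (N := vanishing) hu0), ?_⟩
  rw [principal_mode]
  congr 1
  ext1
  set U : decaying := ⟨u, hu⟩
  filter_upwards [(memLp_ofReal_of_hasCompactSupport hc hs).coeFn_toLp,
    Lp.coeFn_sub (E.lam k ^ 2 • stepMul ℂ b b (toLpZero U)) (toLpTwo U),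
    Lp.coeFn_smul (E.lam k ^ 2) (stepMul ℂ b b (toLpZero U)),
    coeFn_stepMul b b (toLpZero U), coeFn_toLpZero U, coeFn_toLpTwo U]
    with t h1 h2 h3 h4 h5 h6
  rw [h1, h2, Pi.sub_apply, h3, Pi.smul_apply, h4, h5, h6, ← heq t, ite_self, hsq, smul_eq_mul,
    smul_eq_mul]
  change _ * (_ * u t) - deriv (deriv u) t = _
  ring

/-- The function `exp (-|lam k| t)`. -/
noncomputable def expMode (k : ι) : decaying :=
  ⟨fun t : ℝ => Complex.exp (-(‖E.lam k‖ : ℂ) * t),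
    isDecaying_cexp (by simpa using E.lam_ne_zero k)⟩

theorem toLpOne_expMode (k : ι) :
    toLpOne (E.expMode k) = (-(‖E.lam k‖ : ℂ)) • toLpZero (E.expMode k) := by
  ext1
  filter_upwards [coeFn_toLpOne (E.expMode k), coeFn_toLpZero (E.expMode k),
    Lp.coeFn_smul (-(‖E.lam k‖ : ℂ)) (toLpZero (E.expMode k))] with t h1 h2 h3
  rw [h1, h3, Pi.smul_apply, h2]
  exact (hasDerivAt_cexp (-(‖E.lam k‖ : ℂ)) t).deriv

theorem toLpTwo_expMode (k : ι) :
    toLpTwo (E.expMode k) = ((‖E.lam k‖ : ℂ) ^ 2) • toLpZero (E.expMode k) := by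
  ext1
  filter_upwards [coeFn_toLpTwo (E.expMode k), coeFn_toLpZero (E.expMode k),
    Lp.coeFn_smul ((‖E.lam k‖ : ℂ) ^ 2) (toLpZero (E.expMode k))] with t h1 h2 h3
  rw [h1, h3, Pi.smul_apply, h2]
  have e1 : deriv (E.expMode k : ℝ → ℂ) = fun t : ℝ =>
      -(‖E.lam k‖ : ℂ) * Complex.exp (-(‖E.lam k‖ : ℂ) * t) :=
    funext fun t => (hasDerivAt_cexp (-(‖E.lam k‖ : ℂ)) t).deriv
  rw [e1, ((hasDerivAt_cexp (-(‖E.lam k‖ : ℂ)) t).const_mul _).deriv, smul_eq_mul]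
  change _ = _ * Complex.exp (-(‖E.lam k‖ : ℂ) * t)
  ring

theorem norm_sq_toLpZero_expMode (k : ι) :
    ‖toLpZero (E.expMode k)‖ ^ 2 = 1 / (2 * ‖E.lam k‖) := by
  have hpos : 0 < ‖E.lam k‖ := norm_pos_iff.2 (E.lam_ne_zero k)
  rw [norm_sq_eq_integral_of_ae_eq (coeFn_toLpZero _)]
  have h := integral_exp_mul_Ioi (a := -(2 * ‖E.lam k‖)) (by linarith) 0
  have e : ∀ t : ℝ, ‖(E.expMode k : ℝ → ℂ) t‖ ^ 2 = Real.exp (-(2 * ‖E.lam k‖) * t) := by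
    intro t
    change ‖Complex.exp (-(‖E.lam k‖ : ℂ) * t)‖ ^ 2 = _
    rw [Complex.norm_exp, ← Real.exp_nat_mul]
    congr 1
    simp
    ring
  simp_rw [e]
  refine Eq.trans h ?_
  rw [mul_zero, Real.exp_zero, neg_div_neg_eq]

/-- The lift `∑ c k |lam k| ^ (-3 / 2) exp (-|lam k| t) e k` of `∑ c k e k`: each
of the three `L_2`-components has square norm `½ ∑ |c k|²`. -/
theorem exists_lift_of_mem_span {h : H} (hh : h ∈ Submodule.span ℂ (range E.e)) :
    ∃ x ∈ E.space ⊤, Quad.trace H x 0 = h ∧ ‖x‖ ≤ 2 * ‖h‖ := by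
  obtain ⟨c, rfl⟩ := Finsupp.mem_span_range_iff_exists_finsupp.1 hh
  change ∃ x ∈ E.space ⊤, Quad.trace H x 0 = ∑ k ∈ c.support, c k • E.e k
    ∧ ‖x‖ ≤ 2 * ‖∑ k ∈ c.support, c k • E.e k‖
  have hpos : ∀ k, 0 < ‖E.lam k‖ := fun k => norm_pos_iff.2 (E.lam_ne_zero k)
  have hne : ∀ k, ((‖E.lam k‖ ^ (3 / 2 : ℝ) : ℝ) : ℂ) ≠ 0 := fun k =>
    Complex.ofReal_ne_zero.2 (Real.rpow_pos_of_pos (hpos k) _).ne'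
  set d : ι → ℂ := fun k => c k * ((‖E.lam k‖ ^ (3 / 2 : ℝ) : ℝ) : ℂ)⁻¹ with hd
  set x := ∑ k ∈ c.support, E.mode k (d k • E.expMode k) with hx
  have hmem : x ∈ E.space ⊤ := E.trial_le_space _
    (Submodule.sum_mem _ fun k _ => E.mode_mem_trial k Submodule.mem_top)
  have hnorm : ∀ k, ‖d k‖ ^ 2 * ‖E.lam k‖ ^ 4 * (1 / (2 * ‖E.lam k‖)) = ‖c k‖ ^ 2 / 2 := by
    intro k
    have h1 : ‖d k‖ ^ 2 = ‖c k‖ ^ 2 * (‖E.lam k‖ ^ 3)⁻¹ := by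
      rw [hd, norm_mul, mul_pow, norm_inv, Complex.norm_real, Real.norm_of_nonneg (by positivity),
        inv_pow, ← Real.rpow_natCast (_ ^ _), ← Real.rpow_mul (norm_nonneg _),
        ← Real.rpow_natCast _ 3]
      norm_num
    have := (hpos k).ne'
    rw [h1]
    field_simp
  set h' := ∑ k ∈ c.support, c k • E.e k with hh'
  have hsum : ‖h'‖ ^ 2 = ∑ k ∈ c.support, ‖c k‖ ^ 2 := E.norm_sq_sum_smul_e _ _
  have hsq : ‖Quad.sq H x‖ ^ 2 = ‖h'‖ ^ 2 / 2 := by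
    rw [hx, map_sum]
    simp only [sq_mode]
    rw [norm_sq_sum_tensor E.orthonormal, hsum, Finset.sum_div]
    refine Finset.sum_congr rfl fun k _ => ?_
    rw [map_smul, norm_smul, norm_smul, mul_pow, mul_pow, norm_sq_toLpZero_expMode, ← hnorm,
      norm_pow]
    ring
  have hmid : ‖Quad.mid H x‖ ^ 2 = ‖h'‖ ^ 2 / 2 := by
    rw [hx, map_sum]
    simp only [mid_mode]
    rw [norm_sq_sum_tensor E.orthonormal, hsum, Finset.sum_div]
    refine Finset.sum_congr rfl fun k _ => ?_
    rw [map_smul, toLpOne_expMode, norm_smul, norm_smul, norm_smul, mul_pow, mul_pow, mul_pow,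
      norm_sq_toLpZero_expMode, ← hnorm, norm_neg, Complex.norm_real, norm_norm]
    ring
  have htop : ‖Quad.top H x‖ ^ 2 = ‖h'‖ ^ 2 / 2 := by
    rw [hx, map_sum]
    simp only [top_mode]
    rw [norm_sq_sum_tensor E.orthonormal, hsum, Finset.sum_div]
    refine Finset.sum_congr rfl fun k _ => ?_
    rw [map_smul, toLpTwo_expMode, norm_smul, norm_smul, mul_pow, mul_pow,
      norm_sq_toLpZero_expMode, ← hnorm, norm_pow, Complex.norm_real, norm_norm]
    ring
  have hle : ∀ r : ℝ, r ^ 2 = ‖h'‖ ^ 2 / 2 → r ≤ ‖h'‖ := fun r hr =>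
    (abs_le_of_sq_le_sq' (by rw [hr]; linarith [sq_nonneg ‖h'‖]) (norm_nonneg _)).2
  have h0 := hle _ hsq
  have h1 := hle _ hmid
  have h2 := hle _ htop
  have h3 := E.norm_trace_le hmem
  have hn := norm_nonneg h'
  refine ⟨x, hmem, ?_, Quad.norm_le (by linarith) (by linarith) (by linarith) (by linarith)⟩
  rw [hx, map_sum, BoundedContinuousFunction.sum_apply]
  refine Finset.sum_congr rfl fun k _ => ?_
  rw [trace_mode_apply, max_self, Submodule.coe_smul, Pi.smul_apply]
  change (_ * (d k * Complex.exp (-(‖E.lam k‖ : ℂ) * ((0 : ℝ) : ℂ)))) • _ = _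
  rw [Complex.ofReal_zero, mul_zero, Complex.exp_zero, mul_one, hd]
  congr 1
  have := hne k
  field_simp

/-- A function which is orthogonal to all `ψ ⊗ e k`, with test functions `ψ`, vanishes. -/
theorem eq_zero_of_forall_inner_tensor_eq_zero [Countable ι] {h : Lp H 2 halfLine}
    (hh : ∀ (k : ι) (ψ : ℝ → ℝ) (hc : Continuous ψ) (hs : HasCompactSupport ψ),
      ⟪tensor (E.e k) ((memLp_ofReal_of_hasCompactSupport hc hs).toLp _), h⟫_ℂ = 0) : h = 0 := by
  have hk : ∀ k, ∀ᵐ t ∂halfLine, ⟪E.e k, h t⟫_ℂ = 0 := by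
    intro k
    have hg : MemLp (fun t => ⟪E.e k, h t⟫_ℂ) 2 halfLine := (Lp.memLp h).const_inner _
    refine (ae_restrict_iff' measurableSet_Ioi).2
      (isOpen_Ioi.ae_eq_zero_of_integral_contDiff_smul_eq_zero ?_ fun ψ hψ hs h0 => ?_)
    · exact locallyIntegrableOn_of_memLp hg
    · have h1 := hh k ψ hψ.continuous hs
      rw [L2.inner_def] at h1
      have h2 : ∫ t in Ioi (0 : ℝ), ψ t • ⟪E.e k, h t⟫_ℂ = 0 := by
        rw [← h1]
        refine integral_congr_ae ?_
        filter_upwards [coeFn_tensor (E.e k)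
          ((memLp_ofReal_of_hasCompactSupport hψ.continuous hs).toLp _),
          (memLp_ofReal_of_hasCompactSupport hψ.continuous hs).coeFn_toLp] with t e1 e2
        rw [e1, e2, inner_smul_left, Complex.conj_ofReal, Complex.real_smul]
      rw [← h2]
      refine (setIntegral_eq_integral_of_forall_compl_eq_zero fun t ht => ?_).symm
      rw [image_eq_zero_of_notMem_tsupport fun h' => ht (h0 h'), zero_smul]
  rw [Lp.eq_zero_iff_ae_eq_zero]
  filter_upwards [ae_all_iff.2 hk] with t ht
  have hmem : h t ∈ (Submodule.span ℂ (range E.e))ᗮ := by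
    rw [Submodule.mem_orthogonal]
    intro v hv
    induction hv using Submodule.span_induction with
    | mem y hy => obtain ⟨k, rfl⟩ := hy; exact ht k
    | zero => exact inner_zero_left _
    | add y z _ _ hy hz => rw [inner_add_left, hy, hz, add_zero]
    | smul a y _ hy => rw [inner_smul_left, hy, mul_zero]
  rwa [E.orthogonal_span, Submodule.mem_bot] at hmem

variable [CompleteSpace H]

/-- The Dirichlet problem for the principal part is solvable for all right-hand sides. For `a = b`
the range is closed and contains all `ψ ⊗ e k`; the general case follows by the method of
continuity in `a`. -/
theorem principal_surjective [Countable ι] (hC : 0 < C) {a b : ℝ} (ha : 0 < a) (hb : 0 < b) :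
    Function.Surjective (Quad.principal H a b ∘L (E.space vanishing).subtypeL) := by
  have := E.completeSpace_space vanishing
  obtain ⟨K, hK0, hK⟩ := E.exists_norm_le_mul_norm_principal hC (lt_min ha hb)
    (min_le_max (a := a) (b := b))
  have hbI : b ∈ Icc (min a b) (max a b) := ⟨min_le_right _ _, le_max_right _ _⟩
  have haI : a ∈ Icc (min a b) (max a b) := ⟨min_le_left _ _, le_max_left _ _⟩
  have hbase : Function.Surjective (Quad.principal H b b ∘L (E.space vanishing).subtypeL) := by
    refine surjective_of_bound_of_denseRange (fun x => hK b hbI b hbI x x.2) ?_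
    have htop : (LinearMap.range
        (Quad.principal H b b ∘L (E.space vanishing).subtypeL).toLinearMap).topologicalClosure
          = ⊤ := by
      rw [Submodule.topologicalClosure_eq_top_iff, Submodule.eq_bot_iff]
      intro h hh
      refine E.eq_zero_of_forall_inner_tensor_eq_zero fun k ψ hc hs => ?_
      obtain ⟨x, hx, hxe⟩ := E.tensor_mem_range_principal hC hb k hc hs
      exact (Submodule.mem_orthogonal _ _).1 hh _ ⟨⟨x, hx⟩, hxe⟩
    intro y
    have : y ∈ (LinearMap.range (Quad.principal H b b
        ∘L (E.space vanishing).subtypeL).toLinearMap).topologicalClosure := htop ▸ Submodule.mem_top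
    exact this
  set S : E.space vanishing →L[ℂ] Lp H 2 halfLine :=
    unitCutoff H ∘L Quad.sq H ∘L (E.space vanishing).subtypeL with hS
  set T : E.space vanishing →L[ℂ] Lp H 2 halfLine :=
    Quad.principal H 0 b ∘L (E.space vanishing).subtypeL with hT
  have hdecomp : ∀ s : ℝ, Quad.principal H s b ∘L (E.space vanishing).subtypeL
      = T + (s : ℂ) • S := by
    intro s
    ext1 x
    change (b : ℂ) • Quad.sq H x + ((s - b : ℝ) : ℂ) • unitCutoff H (Quad.sq H x) - Quad.top H x
      = (b : ℂ) • Quad.sq H x + ((0 - b : ℝ) : ℂ) • unitCutoff H (Quad.sq H x) - Quad.top H x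
        + (s : ℂ) • unitCutoff H (Quad.sq H x)
    push_cast
    module
  rw [hdecomp] at hbase ⊢
  refine surjective_add_smul_of_forall_bound (K := K) (c := 1) (a := b) (fun s hs x => ?_)
    (fun x => ?_) zero_le_one hK0 hbase
  · rw [← hdecomp]
    exact hK s ((convex_Icc _ _).segment_subset hbI haI hs) b hbI x x.2
  · rw [one_mul]
    exact (norm_unitCutoff_le _).trans (Quad.norm_sq_le _)

/-- Every `h ∈ H` is the trace at `0` of an element of the space, by passing to limits in the lifts
of finite sums of eigenvectors. -/
theorem exists_lift (h : H) :
    ∃ x ∈ E.space ⊤, Quad.trace H x 0 = h ∧ ‖x‖ ≤ 3 * ‖h‖ := by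
  have := E.completeSpace_space ⊤
  let f : E.space ⊤ →L[ℂ] H := (BoundedContinuousFunction.evalCLM ℂ (0 : ℝ)) ∘L Quad.trace H
    ∘L (E.space ⊤).subtypeL
  let g : NormedAddGroupHom (E.space ⊤) H :=
    f.toLinearMap.toAddMonoidHom.mkNormedAddGroupHom ‖f‖ f.le_opNorm
  have hg : g.SurjectiveOnWith (Submodule.span ℂ (range E.e)).toAddSubgroup 2 := by
    intro y hy
    obtain ⟨x, hx, hx0, hxn⟩ := E.exists_lift_of_mem_span hy
    exact ⟨⟨x, hx⟩, hx0, hxn⟩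
  have hcl := controlled_closure_of_complete two_pos one_pos hg
  have hmem : h ∈ (Submodule.span ℂ (range E.e)).topologicalClosure := by
    rw [Submodule.topologicalClosure_eq_top_iff.2 E.orthogonal_span]
    exact Submodule.mem_top
  obtain ⟨x, hx0, hxn⟩ := hcl h hmem
  exact ⟨x, x.2, hx0, by norm_num at hxn; exact hxn⟩

end SectorialEigenbasis

end Solvability

/-! ### Sharp constants and the full equation -/

section SharpEstimates

theorem cos_pos_of_sector {ε : ℝ} (hε₀ : 0 ≤ ε) (hε : ε < Real.pi / 2) : 0 < Real.cos ε :=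
  Real.cos_pos_of_mem_Ioo ⟨by linarith [Real.pi_pos], hε⟩

theorem sectorFactor_pos {ε : ℝ} (hε₀ : 0 ≤ ε) (hε : ε < Real.pi / 2) : 0 < sectorFactor ε := by
  have := cos_pos_of_sector hε₀ hε
  rw [sectorFactor]
  split_ifs <;> positivity

theorem two_mul_cos_pi_div_four_sq : 2 * Real.cos (Real.pi / 4) ^ 2 = 1 := by
  rw [Real.cos_pi_div_four, div_pow, Real.sq_sqrt (by norm_num)]
  norm_num

theorem one_le_sectorFactor_sq {ε : ℝ} (hε₀ : 0 ≤ ε) (hε : ε < Real.pi / 2) :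
    1 ≤ sectorFactor ε ^ 2 := by
  have hpos := cos_pos_of_sector hε₀ hε
  rw [sectorFactor]
  split_ifs with h
  · simp
  · have hle : Real.cos ε ≤ Real.cos (Real.pi / 4) :=
      Real.cos_le_cos_of_nonneg_of_le_pi (by positivity) (by linarith [Real.pi_pos])
        (not_lt.1 h)
    have := pow_le_pow_left₀ hpos.le hle 2
    rw [div_pow, mul_pow, Real.sq_sqrt (by norm_num), one_pow, one_le_div (by positivity)]
    linarith [two_mul_cos_pi_div_four_sq]

theorem one_le_two_mul_cos_sq_mul_sectorFactor_sq {ε : ℝ} (hε₀ : 0 ≤ ε) (hε : ε < Real.pi / 2) :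
    1 ≤ 2 * Real.cos ε ^ 2 * sectorFactor ε ^ 2 := by
  have hpos := cos_pos_of_sector hε₀ hε
  rw [sectorFactor]
  split_ifs with h
  · have hle : Real.cos (Real.pi / 4) ≤ Real.cos ε :=
      Real.cos_le_cos_of_nonneg_of_le_pi hε₀ (by linarith [Real.pi_pos]) h.le
    have := pow_le_pow_left₀ (Real.cos_nonneg_of_neg_pi_div_two_le_of_le
      (by linarith [Real.pi_pos]) (by linarith [Real.pi_pos])) hle 2
    linarith [two_mul_cos_pi_div_four_sq]
  · rw [div_pow, mul_pow, Real.sq_sqrt (by norm_num), one_pow, mul_one_div_cancel (by positivity)]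

theorem min_sq_eq {α β : ℝ} (hα : 0 < α) (hβ : 0 < β) : min (α ^ 2) (β ^ 2) = min α β ^ 2 := by
  rcases le_total α β with h | h
  · rw [min_eq_left h, min_eq_left (pow_le_pow_left₀ hα.le h 2)]
  · rw [min_eq_right h, min_eq_right (pow_le_pow_left₀ hβ.le h 2)]

theorem max_sq_eq {α β : ℝ} (hα : 0 < α) (hβ : 0 < β) : max (α ^ 2) (β ^ 2) = max α β ^ 2 := by
  rcases le_total α β with h | h
  · rw [max_eq_right h, max_eq_right (pow_le_pow_left₀ hα.le h 2)]
  · rw [max_eq_left h, max_eq_left (pow_le_pow_left₀ hβ.le h 2)]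

variable {H : Type*} [NormedAddCommGroup H] [InnerProductSpace ℂ H] {R : H →L[ℂ] H} {ι : Type*}

/-- The estimates of the components by the principal part, with the constants of the smallness
condition. -/
theorem SectorialEigenbasis.norm_le_mul_norm_principal {α β ε : ℝ} (hα : 0 < α) (hβ : 0 < β)
    (hε₀ : 0 ≤ ε) (hε : ε < Real.pi / 2) (E : SectorialEigenbasis R (Real.cos ε) ι) {x : Quad H}
    (hx : x ∈ E.space vanishing) :
    ‖Quad.sq H x‖ ≤ c0 ε α β * ‖Quad.principal H (α ^ 2) (β ^ 2) x‖ ∧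
      ‖Quad.mid H x‖ ≤ c1 ε α β * ‖Quad.principal H (α ^ 2) (β ^ 2) x‖ ∧
      ‖Quad.top H x‖ ≤ c2 ε α β * ‖Quad.principal H (α ^ 2) (β ^ 2) x‖ := by
  have hcos := cos_pos_of_sector hε₀ hε
  have hsf := sectorFactor_pos hε₀ hε
  have hmin : 0 < min α β := lt_min hα hβ
  have hmax : 0 < max α β := lt_max_of_lt_left hα
  obtain ⟨h1, h0, h2⟩ := E.energy_estimates (a := α ^ 2) (b := β ^ 2) (m := min α β ^ 2)
    (M := max α β ^ 2) hcos (one_le_sectorFactor_sq hε₀ hε)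
    (one_le_two_mul_cos_sq_mul_sectorFactor_sq hε₀ hε) (by positivity)
    (by rw [← min_sq_eq hα hβ, ← max_sq_eq hα hβ]; exact ⟨min_le_left _ _, le_max_left _ _⟩)
    (by rw [← min_sq_eq hα hβ, ← max_sq_eq hα hβ]; exact ⟨min_le_right _ _, le_max_right _ _⟩) hx
  rw [c0, c1, c2, min_sq_eq hα hβ]
  refine ⟨?_, ?_, ?_⟩
  · refine le_mul_of_mul_sq_le (by positivity) h0 (le_of_eq ?_) (by positivity) (norm_nonneg _)
    field_simp
  · refine le_mul_of_mul_sq_le (c := 4 * Real.cos ε ^ 2 * min α β ^ 2) (d := 1) (by positivity)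
      (by linarith) (le_of_eq ?_) (by positivity) (norm_nonneg _)
    field_simp
    norm_num
  · rw [← mul_assoc] at h2
    refine le_mul_of_mul_sq_le (by positivity) h2 (le_of_eq ?_) (by positivity) (norm_nonneg _)
    field_simp

end SharpEstimates

section FullEquation

variable {H : Type*} [NormedAddCommGroup H] [InnerProductSpace ℂ H] {R : H →L[ℂ] H} {ι : Type*}

namespace Quad

/-- The lower order part `A₀ u'' + A₁ u' + A₂ u = B₀ u'' + B₁ (A u') + B₂ (A² u)`. -/
noncomputable def lower (B : Fin 3 → (H →L[ℂ] H)) : Quad H →L[ℂ] Lp H 2 halfLine :=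
  (B 0).compLpL 2 halfLine ∘L top H + (B 1).compLpL 2 halfLine ∘L mid H
    + (B 2).compLpL 2 halfLine ∘L sq H

theorem norm_lower_le (B : Fin 3 → (H →L[ℂ] H)) (x : Quad H) :
    ‖lower B x‖ ≤ ‖B 0‖ * ‖top H x‖ + ‖B 1‖ * ‖mid H x‖ + ‖B 2‖ * ‖sq H x‖ := by
  refine (norm_add₃_le).trans (add_le_add (add_le_add ?_ ?_) ?_)
  · exact (B 0).norm_compLp_le (top H x)
  · exact (B 1).norm_compLp_le (mid H x)
  · exact (B 2).norm_compLp_le (sq H x)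

theorem ae_of_principal_add_lower_eq_zero {B : Fin 3 → (H →L[ℂ] H)} {α β : ℝ} {x : Quad H}
    (hx : principal H (α ^ 2) (β ^ 2) x + lower B x = 0) :
    ∀ᵐ t ∂halfLine, -top H x t + ((rho α β t : ℝ) : ℂ) • sq H x t + B 0 (top H x t)
      + B 1 (mid H x t) + B 2 (sq H x t) = 0 := by
  have e : principal H (α ^ 2) (β ^ 2) x + lower B x
      = (stepMul H (α ^ 2) (β ^ 2) (sq H x) - top H x) + ((B 0).compLpL 2 halfLine (top H x)
        + (B 1).compLpL 2 halfLine (mid H x) + (B 2).compLpL 2 halfLine (sq H x)) := rfl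
  rw [e] at hx
  have h0 := (Lp.eq_zero_iff_ae_eq_zero).1 hx
  filter_upwards [h0, Lp.coeFn_add (stepMul H (α ^ 2) (β ^ 2) (sq H x) - top H x)
    ((B 0).compLpL 2 halfLine (top H x) + (B 1).compLpL 2 halfLine (mid H x)
      + (B 2).compLpL 2 halfLine (sq H x)),
    Lp.coeFn_sub (stepMul H (α ^ 2) (β ^ 2) (sq H x)) (top H x),
    Lp.coeFn_add ((B 0).compLpL 2 halfLine (top H x) + (B 1).compLpL 2 halfLine (mid H x))
      ((B 2).compLpL 2 halfLine (sq H x)),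
    Lp.coeFn_add ((B 0).compLpL 2 halfLine (top H x)) ((B 1).compLpL 2 halfLine (mid H x)),
    coeFn_stepMul (α ^ 2) (β ^ 2) (sq H x), (B 0).coeFn_compLpL (top H x),
    (B 1).coeFn_compLpL (mid H x), (B 2).coeFn_compLpL (sq H x)]
    with t k0 k1 k2 k3 k4 k5 k6 k7 k8
  rw [k1, Pi.add_apply, k2, Pi.sub_apply, k3, Pi.add_apply, k4, Pi.add_apply, k5, k6, k7, k8] at k0
  rw [rho, ← k0.trans (Pi.zero_apply t)]
  abel

end Quad

namespace SectorialEigenbasis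

theorem space_le_space_top {C : ℝ} (E : SectorialEigenbasis R C ι) (N : Submodule ℂ decaying) :
    E.space N ≤ E.space ⊤ := by
  refine Submodule.topologicalClosure_mono fun x hx => ?_
  obtain ⟨s, u, -, rfl⟩ := E.exists_eq_sum_of_mem_trial hx
  exact Submodule.sum_mem _ fun k _ => E.mode_mem_trial k Submodule.mem_top

theorem trace_zero_of_mem_space_vanishing {C : ℝ} (E : SectorialEigenbasis R C ι) {x : Quad H}
    (hx : x ∈ E.space vanishing) : Quad.trace H x 0 = 0 := by
  refine E.apply_eq_zero_of_mem_space
    ((BoundedContinuousFunction.evalCLM ℂ (0 : ℝ)) ∘L Quad.trace H) (fun k u hu => ?_) hx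
  change Quad.trace H (E.mode k u) 0 = 0
  rw [trace_mode_apply, max_self, mem_vanishing.1 hu, mul_zero, zero_smul]

variable [CompleteSpace H]

/-- The abstract boundary value problem: for every `h = |A| ^ (3 / 2) φ` there is a solution whose
trace function starts at `h`, with control of the norm. It is the sum of a lift of `h` and of the
solution of a Dirichlet problem, which exists by perturbation of the principal part. -/
theorem exists_solution [Countable ι] {α β ε : ℝ} (hα : 0 < α) (hβ : 0 < β)
    (hε₀ : 0 ≤ ε) (hε : ε < Real.pi / 2) (E : SectorialEigenbasis R (Real.cos ε) ι)
    {B : Fin 3 → (H →L[ℂ] H)}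
    (hsmall : c0 ε α β * ‖B 2‖ + c1 ε α β * ‖B 1‖ + c2 ε α β * ‖B 0‖ < 1) :
    ∃ K : ℝ, 0 ≤ K ∧ ∀ h : H, ∃ x ∈ E.space ⊤, Quad.trace H x 0 = h ∧
      Quad.principal H (α ^ 2) (β ^ 2) x + Quad.lower B x = 0 ∧ ‖x‖ ≤ K * ‖h‖ := by
  have hcos := cos_pos_of_sector hε₀ hε
  have hsf := sectorFactor_pos hε₀ hε
  have hmin : 0 < min α β := lt_min hα hβ
  have hmin2 : 0 < min (α ^ 2) (β ^ 2) := lt_min (by positivity) (by positivity)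
  have hmax : 0 < max α β := lt_max_of_lt_left hα
  have := E.completeSpace_space vanishing
  set q := c0 ε α β * ‖B 2‖ + c1 ε α β * ‖B 1‖ + c2 ε α β * ‖B 0‖ with hq
  have hq0 : 0 ≤ q := by
    rw [hq, c0, c1, c2]
    positivity
  set P := Quad.principal H (α ^ 2) (β ^ 2) with hP
  have hlower : ∀ x ∈ E.space vanishing, ‖Quad.lower B x‖ ≤ q * ‖P x‖ := by
    intro x hx
    obtain ⟨h0, h1, h2⟩ := E.norm_le_mul_norm_principal hα hβ hε₀ hε hx
    calc ‖Quad.lower B x‖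
        ≤ ‖B 0‖ * ‖Quad.top H x‖ + ‖B 1‖ * ‖Quad.mid H x‖ + ‖B 2‖ * ‖Quad.sq H x‖ :=
          Quad.norm_lower_le B x
      _ ≤ ‖B 0‖ * (c2 ε α β * ‖P x‖) + ‖B 1‖ * (c1 ε α β * ‖P x‖)
          + ‖B 2‖ * (c0 ε α β * ‖P x‖) := by gcongr
      _ = q * ‖P x‖ := by rw [hq]; ring
  obtain ⟨K₀, hK₀, hK⟩ := E.exists_norm_le_mul_norm_principal hcos hmin2 min_le_max
  have hbound : ∀ x ∈ E.space vanishing, ‖x‖ ≤ K₀ * ‖P x‖ := fun x hx =>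
    hK (α ^ 2) ⟨min_le_left _ _, le_max_left _ _⟩ (β ^ 2) ⟨min_le_right _ _, le_max_right _ _⟩ x hx
  have hsurj := surjective_add_of_norm_le
    (E.principal_surjective hcos (pow_pos hα 2) (pow_pos hβ 2)) (K := K₀)
    (S := Quad.lower B ∘L (E.space vanishing).subtypeL) (fun x => hbound x x.2) hq0 hsmall
    (fun x => hlower x x.2)
  set K₁ := K₀ / (1 - q) with hK₁
  have h1q : 0 < 1 - q := by linarith
  have hbound' : ∀ x ∈ E.space vanishing, ‖x‖ ≤ K₁ * ‖P x + Quad.lower B x‖ := by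
    intro x hx
    have h1 : (1 - q) * ‖P x‖ ≤ ‖P x + Quad.lower B x‖ := by
      have h2 := norm_sub_le (P x + Quad.lower B x) (Quad.lower B x)
      rw [add_sub_cancel_right] at h2
      linarith [hlower x hx]
    rw [hK₁, div_mul_eq_mul_div, le_div_iff₀ h1q]
    calc ‖x‖ * (1 - q) ≤ K₀ * ‖P x‖ * (1 - q) :=
          mul_le_mul_of_nonneg_right (hbound x hx) h1q.le
      _ = K₀ * ((1 - q) * ‖P x‖) := by ring
      _ ≤ _ := mul_le_mul_of_nonneg_left h1 hK₀
  refine ⟨3 + K₁ * (‖P + Quad.lower B‖ * 3), by positivity, fun h => ?_⟩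
  obtain ⟨x₀, hx₀, htr, hx₀n⟩ := E.exists_lift h
  obtain ⟨⟨x₁, hx₁⟩, hx₁e⟩ := hsurj (-(P x₀ + Quad.lower B x₀))
  have hx₁e' : P x₁ + Quad.lower B x₁ = -(P x₀ + Quad.lower B x₀) := hx₁e
  refine ⟨x₀ + x₁, Submodule.add_mem _ hx₀ (E.space_le_space_top _ hx₁), ?_, ?_, ?_⟩
  · rw [map_add, BoundedContinuousFunction.add_apply, htr,
      E.trace_zero_of_mem_space_vanishing hx₁, add_zero]
  · rw [map_add, map_add, add_add_add_comm, hx₁e', add_neg_cancel]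
  · have h2 := hbound' x₁ hx₁
    rw [hx₁e', norm_neg] at h2
    have h3 : ‖P x₀ + Quad.lower B x₀‖ ≤ ‖P + Quad.lower B‖ * (3 * ‖h‖) :=
      ((P + Quad.lower B).le_opNorm x₀).trans (mul_le_mul_of_nonneg_left hx₀n (norm_nonneg _))
    have hK₁0 : 0 ≤ K₁ := by positivity
    calc ‖x₀ + x₁‖ ≤ ‖x₀‖ + ‖x₁‖ := norm_add_le _ _
      _ ≤ 3 * ‖h‖ + K₁ * (‖P + Quad.lower B‖ * (3 * ‖h‖)) :=
          add_le_add hx₀n (h2.trans (mul_le_mul_of_nonneg_left h3 hK₁0))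
      _ = _ := by ring

end SectorialEigenbasis

end FullEquation

section Realization

variable {H : Type*} [NormedAddCommGroup H] [InnerProductSpace ℂ H] [CompleteSpace H]
  {R : H →L[ℂ] H} {C : ℝ} {ι : Type*} (E : SectorialEigenbasis R C ι)

namespace SectorialEigenbasis

variable (hcomm : ∀ h, R (R.adjoint h) = R.adjoint (R h)) {x : Quad H} (hx : x ∈ E.space ⊤)

include hcomm hx in
/-- The function `u` belonging to the quadruple `x` is `|R| ^ (3 / 2)` of the trace function; its
derivative is `R (A u')`. -/
theorem isWeakDeriv_absPow_trace :
    IsWeakDeriv (fun t => absPow R (3 / 2) (Quad.trace H x t)) (fun t => R (Quad.mid H x t)) where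
  locInt := by
    have : Continuous fun t => absPow R (3 / 2) (Quad.trace H x t) :=
      (absPow R (3 / 2)).continuous.comp (Quad.trace H x).continuous
    exact this.locallyIntegrable.locallyIntegrableOn _
  locInt_deriv := locallyIntegrableOn_of_memLp (R.comp_memLp' (Lp.memLp (Quad.mid H x)))
  integral_eq ψ hψ hs h0 := by
    have h := E.absPow_testBdd_deriv_trace hcomm hψ hs h0 hx
    rw [testBdd_apply, testLp_apply, ← ContinuousLinearMap.integral_comp_comm _
      (integrable_test_smul_bdd (hψ.continuous_deriv (by simp)) hs.deriv _),
      ← ContinuousLinearMap.integral_comp_comm _ (integrable_test_smul hψ.continuous hs _)] at h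
    simp only [ContinuousLinearMap.map_smul_of_tower] at h
    exact h

include hx in
theorem isWeakDeriv_mid :
    IsWeakDeriv (fun t => R (Quad.mid H x t)) (Quad.top H x) where
  locInt := locallyIntegrableOn_of_memLp (R.comp_memLp' (Lp.memLp (Quad.mid H x)))
  locInt_deriv := locallyIntegrableOn_of_memLp (Lp.memLp (Quad.top H x))
  integral_eq ψ hψ hs h0 := by
    have h := E.apply_testLp_deriv_mid hψ hs h0 hx
    rw [testLp_apply, testLp_apply, ← ContinuousLinearMap.integral_comp_comm _
      (integrable_test_smul (hψ.continuous_deriv (by simp)) hs.deriv _)] at h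
    simp only [ContinuousLinearMap.map_smul_of_tower] at h
    exact h

include hcomm hx in
/-- The identity `u = R² (A² u)` holds almost everywhere, since it holds after testing. -/
theorem ae_absPow_trace_eq :
    ∀ᵐ t ∂halfLine, absPow R (3 / 2) (Quad.trace H x t) = R (R (Quad.sq H x t)) := by
  have hc : Continuous fun t => absPow R (3 / 2) (Quad.trace H x t) :=
    (absPow R (3 / 2)).continuous.comp (Quad.trace H x).continuous
  have hm : MemLp (fun t => R (R (Quad.sq H x t))) 2 halfLine :=
    R.comp_memLp' (R.comp_memLp' (Lp.memLp (Quad.sq H x)))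
  have key := isOpen_Ioi.ae_eq_zero_of_integral_contDiff_smul_eq_zero
    (f := fun t => absPow R (3 / 2) (Quad.trace H x t) - R (R (Quad.sq H x t)))
    (U := Ioi (0 : ℝ)) (μ := volume)
    ((hc.locallyIntegrable.locallyIntegrableOn _).sub (locallyIntegrableOn_of_memLp hm))
    fun ψ hψ hs h0 => by
      have i1 := integrable_test_smul_bdd hψ.continuous hs (Quad.trace H x)
      have i2 := integrable_test_smul hψ.continuous hs (Quad.sq H x)
      have h := E.absPow_testBdd_trace hcomm hψ.continuous hs hx
      rw [testBdd_apply, testLp_apply, ← ContinuousLinearMap.integral_comp_comm _ i1,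
        ← ContinuousLinearMap.integral_comp_comm _ i2,
        ← ContinuousLinearMap.integral_comp_comm _ (R.integrable_comp i2), ← sub_eq_zero,
        ← integral_sub ((absPow R (3 / 2)).integrable_comp i1)
          (R.integrable_comp (R.integrable_comp i2))] at h
      refine Eq.trans ?_ h
      refine Eq.trans (setIntegral_eq_integral_of_forall_compl_eq_zero (s := Ioi (0 : ℝ))
        fun t ht => ?_).symm (integral_congr_ae (Eventually.of_forall fun t => ?_))
      · rw [image_eq_zero_of_notMem_tsupport fun h' => ht (h0 h'), zero_smul]
      · simp only [ContinuousLinearMap.map_smul_of_tower, smul_sub]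
  refine (ae_restrict_iff' measurableSet_Ioi).2 (key.mono fun t ht hpos => ?_)
  exact sub_eq_zero.1 (ht hpos)

end SectorialEigenbasis

/-- By injectivity of `|R| ^ (3 / 2)` the infimum in `scaleNorm` is over one vector only. -/
theorem enorm_le_scaleNorm (hinj : Function.Injective R) (y : H) :
    ‖y‖ₑ ≤ scaleNorm R (3 / 2) (absPow R (3 / 2) y) :=
  le_iInf₂ fun z hz => by rw [absPow_injective hinj hz]

omit [CompleteSpace H] in
theorem w22Norm_le (x : Quad H) :
    w22Norm (Quad.top H x) (Quad.sq H x) ≤ 2 * ‖x‖ₑ := by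
  have e1 : eLpNorm (Quad.top H x) 2 halfLine ≤ ‖x‖ₑ := by
    rw [← Lp.enorm_def]
    exact enorm_le_iff_norm_le.2 (Quad.norm_top_le x)
  have e2 : eLpNorm (Quad.sq H x) 2 halfLine ≤ ‖x‖ₑ := by
    rw [← Lp.enorm_def]
    exact enorm_le_iff_norm_le.2 (Quad.norm_sq_le x)
  calc w22Norm (Quad.top H x) (Quad.sq H x) ≤ (‖x‖ₑ ^ 2 + ‖x‖ₑ ^ 2) ^ (1 / 2 : ℝ) := by
        rw [w22Norm]
        gcongr
    _ ≤ ((2 * ‖x‖ₑ) ^ 2) ^ (1 / 2 : ℝ) := by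
        gcongr
        rw [← two_mul, mul_pow]
        gcongr
        norm_num
    _ = 2 * ‖x‖ₑ := by
        rw [← ENNReal.rpow_natCast, ← ENNReal.rpow_mul]
        norm_num

omit [CompleteSpace H] in
theorem solvesEquation_of_ae {Aj : Fin 3 → (H →ₗ.[ℂ] H)} {B : Fin 3 → (H →L[ℂ] H)}
    (hB : ∀ (j : Fin 3) (x : H), ((R ^ (j : ℕ)) x, B j x) ∈ (Aj j).graph) {α β : ℝ} {x : Quad H}
    {u : ℝ → H} (hu : ∀ᵐ t ∂halfLine, u t = R (R (Quad.sq H x t)))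
    (heq : Quad.principal H (α ^ 2) (β ^ 2) x + Quad.lower B x = 0) :
    SolvesEquation Aj α β u (fun t => R (Quad.mid H x t)) (Quad.top H x) (Quad.sq H x) := by
  have hB0 : ∀ y, (y, B 0 y) ∈ (Aj 0).graph := hB 0
  have hB1 : ∀ y, (R y, B 1 y) ∈ (Aj 1).graph := fun y => by
    have h := hB 1 y
    rwa [show ((1 : Fin 3) : ℕ) = 1 from rfl, pow_one] at h
  have hB2 : ∀ y, (R (R y), B 2 y) ∈ (Aj 2).graph := fun y => by
    have h := hB 2 y
    rwa [show ((2 : Fin 3) : ℕ) = 2 from rfl, pow_two] at h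
  filter_upwards [hu, Quad.ae_of_principal_add_lower_eq_zero heq] with t ht hsol
  exact ⟨_, _, _, hB0 _, hB1 _, ht ▸ hB2 _, hsol⟩

theorem scaleNorm_absPow_le (γ : ℝ) (y : H) : scaleNorm R γ (absPow R γ y) ≤ ‖y‖ₑ :=
  iInf₂_le_of_le y rfl le_rfl

theorem tendsto_scaleNorm_absPow {f : ℝ → H} (hf : Continuous f) (γ : ℝ) :
    Tendsto (fun t => scaleNorm R γ (absPow R γ (f t) - absPow R γ (f 0))) (𝓝[>] 0) (𝓝 0) := by
  have hlim : Tendsto (fun t => ‖f t - f 0‖ₑ) (𝓝 0) (𝓝 ‖f 0 - f 0‖ₑ) :=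
    (hf.sub continuous_const).enorm.tendsto 0
  rw [sub_self, enorm_zero] at hlim
  refine tendsto_of_tendsto_of_tendsto_of_le_of_le tendsto_const_nhds
    (hlim.mono_left nhdsWithin_le_nhds) (fun _ => zero_le) fun t => ?_
  change scaleNorm R γ (absPow R γ (f t) - absPow R γ (f 0)) ≤ _
  rw [← map_sub]
  exact scaleNorm_absPow_le γ _

end Realization

end OpDiffEq

theorem theorem1 {H : Type*} [NormedAddCommGroup H] [InnerProductSpace ℂ H] [CompleteSpace H]
    [TopologicalSpace.SeparableSpace H]
    (α β ε : ℝ) (hα : 0 < α) (hβ : 0 < β) (hε₀ : 0 ≤ ε) (hε : ε < Real.pi / 2)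
    -- the normal operator `A`, its compact inverse `R = A⁻¹`, its spectrum in the sector
    (A : H →ₗ.[ℂ] H) (hA : OpDiffEq.IsNormal A)
    (R : H →L[ℂ] H) (hR : OpDiffEq.IsResolventAt A 0 R) (hRc : IsCompactOperator R)
    (hspec : ∀ z ∈ OpDiffEq.opSpectrum A, |Complex.arg z| ≤ ε)
    -- the operators `A_j` and the bounded operators `B_j = A_j A^{-j}` on `H`
    (Aj : Fin 3 → (H →ₗ.[ℂ] H)) (B : Fin 3 → (H →L[ℂ] H))
    (hB : ∀ (j : Fin 3) (x : H), ((R ^ (j : ℕ)) x, B j x) ∈ (Aj j).graph)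
    (hsmall : OpDiffEq.c0 ε α β * ‖B 2‖ + OpDiffEq.c1 ε α β * ‖B 1‖
      + OpDiffEq.c2 ε α β * ‖B 0‖ < 1) :
    OpDiffEq.RegularlySolvable A R Aj α β := by
  obtain ⟨s, ⟨E⟩⟩ := OpDiffEq.exists_sectorialEigenbasis hA hR hRc hε hspec
  have hcomm := hA.commute_adjoint hR
  have := E.countable
  obtain ⟨K, hK0, hK⟩ := E.exists_solution hα hβ hε₀ hε hsmall
  refine ⟨2 * K.toNNReal, ?_⟩
  rintro φ ⟨h, rfl⟩
  obtain ⟨x, hx, htr, heq, hn⟩ := hK h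
  have hae := E.ae_absPow_trace_eq hcomm hx
  refine ⟨_, _, _, _, ⟨E.isWeakDeriv_absPow_trace hcomm hx, E.isWeakDeriv_mid hx, Lp.memLp _,
    hae.mono fun t ht => ⟨R (OpDiffEq.Quad.sq H x t), ?_, hR.mem_graph _⟩, Lp.memLp _⟩,
    OpDiffEq.solvesEquation_of_ae hB hae heq, ?_, ?_⟩
  · rw [ht]
    exact hR.mem_graph _
  · have hlim := OpDiffEq.tendsto_scaleNorm_absPow (R := R)
      (OpDiffEq.Quad.trace H x).continuous (3 / 2)
    rw [htr] at hlim
    exact hlim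
  · have hxe : ‖x‖ₑ ≤ K.toNNReal * ‖h‖ₑ := by
      have := ENNReal.ofReal_le_ofReal hn
      rwa [ENNReal.ofReal_mul hK0, ofReal_norm, ofReal_norm] at this
    rw [ENNReal.coe_mul, mul_assoc]
    refine (OpDiffEq.w22Norm_le x).trans (mul_le_mul_right (hxe.trans ?_) _)
    exact mul_le_mul_right (OpDiffEq.enorm_le_scaleNorm hR.injective h) _
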